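/- For a nondegenerate triangle $ABC$ in the Euclidean plane with side lengths $a=BC$, $b=CA$, $c=AB$, let $X_n$ $(1\le n\le 10)$ be the point with homogeneous barycentric coordinates $\bigl(f_n(a,b,c):f_n(b,c,a):f_n(c,a,b)\bigr)$, where $f_1=a$ (incenter), $f_2=1$ (centroid), $f_3=a^2(a^2-b^2-c^2)$ (circumcenter), $f_4=(a^2+b^2-c^2)(a^2-b^2+c^2)$ (orthocenter), $f_5=c^4-a^2b^2+b^4-a^2c^2-2b^2c^2$ (nine-point center), $f_6=a^2$ (symmedian point), $f_7=(a+b-c)(a-b+c)$ (Gergonne point), $f_8=a-b-c$ (Nagel point), $f_9=a(a-b-c)$ (mittenpunkt), $f_{10}=b+c$ (Spieker center). Let $D(i,j)$ be the distance between $X_i$ and $X_j$. **Theorem.** For all $i<j$ in $\{1,\dots,10\}\setminus\{6\}$ the following are the best possible lower and upper bounds for the ratio $D(6,i)/D(6,j)$ over all triangles. That is, a listed bound $k\le D(6,i)/D(6,j)$ (resp. $D(6,i)/D(6,j)\le k$) means that $k\,D(6,j)\le D(6,i)$ (resp. $D(6,i)\le k\,D(6,j)$) for all triangles, and that $k$ is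 the infimum (resp. supremum) of $D(6,i)/D(6,j)$ over all triangles with $D(6,j)\neq 0$. Where no lower bound is listed the infimum is $0$; where no upper bound is listed the ratio is unbounded above. $$\frac{D(6,1)}{D(6,2)}\le 9-6\sqrt2,\quad \frac{D(6,1)}{D(6,3)}\le 2-\sqrt3,\quad \frac12\le\frac{D(6,1)}{D(6,7)},\quad \frac{D(6,1)}{D(6,8)}\le\frac{2\sqrt2-1}{7},$$ $$\frac{D(6,1)}{D(6,9)}\le\frac13,\quad \frac{D(6,1)}{D(6,10)}\le\sqrt2-1,\quad \frac{D(6,2)}{D(6,3)}\le\frac23,\quad 1\le\frac{D(6,2)}{D(6,7)},$$ $$\frac13\le\frac{D(6,2)}{D(6,8)}\le\frac{5+4\sqrt2}{21},\quad \frac12\le\frac{D(6,2)}{D(6,9)}\le\frac34,\quad \frac23\le\frac{D(6,2)}{D(6,10)}\le\frac{1+\sqrt2}{3},$$ $$\frac12\le\frac{D(6,3)}{D(6,4)},\quad 2\le\frac{D(6,3)}{D(6,5)},\quad C_6\le\frac{D(6,3)}{D(6,7)},\quad \frac12\le\frac{D(6,3)}{D(6,8)},\quad 1\le\frac{D(6,3)}{D(6,9)},\quad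 1\le\frac{D(6,3)}{D(6,10)},$$ $$\frac{D(6,7)}{D(6,8)}\le\frac12,\quad \frac{D(6,7)}{D(6,9)}\le\frac12,\quad \frac{D(6,7)}{D(6,10)}\le\frac45,$$ $$1\le\frac{D(6,8)}{D(6,9)}\le2,\quad 3-\sqrt2\le\frac{D(6,8)}{D(6,10)}\le2,\quad 1\le\frac{D(6,9)}{D(6,10)}\le\frac85.$$ (No bound is listed for $(i,j)=(1,4),(1,5),(2,4),(2,5)$, for $i=4$ and $j\in\{5,7,8,9,10\}$, and for $i=5$ and $j\in\{7,8,9,10\}$.) Here $C_6\approx 7.8631112181$ (to ten decimal places) is the largest real root of $$6967296x^{20}+2015974656x^{18}-160813808784x^{16}+603818269839x^{14}-894980577861x^{12}+677249814873x^{10}$$ $$-274035844587x^{8}+60418557684x^{6}-6782842860x^{4}+290960784x^{2}+7744.$$ -/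

import Mathlib

noncomputable section

namespace TriangleCenters

/-- The Euclidean plane. -/
abbrev Plane : Type := EuclideanSpace ℝ (Fin 2)

/-- A (nondegenerate) triangle `ABC` in the plane, with `A = points 0`, `B = points 1`,
`C = points 2`. -/
abbrev Tri : Type := Affine.Triangle ℝ Plane

/-- The side length `a = BC`. -/
def sideA (T : Tri) : ℝ := dist (T.points 1) (T.points 2)

/-- The side length `b = CA`. -/
def sideB (T : Tri) : ℝ := dist (T.points 2) (T.points 0)

/-- The side length `c = AB`. -/
def sideC (T : Tri) : ℝ := dist (T.points 0) (T.points 1)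

/-- The first (homogeneous) barycentric coordinate `f(a,b,c)` of the triangle center `X_n`,
`1 ≤ n ≤ 10`: incenter, centroid, circumcenter, orthocenter, nine-point center,
symmedian point, Gergonne point, Nagel point, mittenpunkt, Spieker center.
The value for other indices is irrelevant. -/
def firstCoord (n : ℕ) (a b c : ℝ) : ℝ :=
  match n with
  | 1 => a
  | 2 => 1
  | 3 => a ^ 2 * (a ^ 2 - b ^ 2 - c ^ 2)
  | 4 => (a ^ 2 + b ^ 2 - c ^ 2) * (a ^ 2 - b ^ 2 + c ^ 2)
  | 5 => c ^ 4 - a ^ 2 * b ^ 2 + b ^ 4 - a ^ 2 * c ^ 2 - 2 * b ^ 2 * c ^ 2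
  | 6 => a ^ 2
  | 7 => (a + b - c) * (a - b + c)
  | 8 => a - b - c
  | 9 => a * (a - b - c)
  | 10 => b + c
  | _ => 0

/-- The homogeneous barycentric coordinates `(f(a,b,c) : f(b,c,a) : f(c,a,b))` of `X_n`. -/
def bary (T : Tri) (n : ℕ) : Fin 3 → ℝ :=
  ![firstCoord n (sideA T) (sideB T) (sideC T),
    firstCoord n (sideB T) (sideC T) (sideA T),
    firstCoord n (sideC T) (sideA T) (sideB T)]

/-- The triangle center `X_n`: the point of the plane with barycentric coordinates `bary T n`
with respect to `ABC`, that is `(u A + v B + w C) / (u + v + w)`. (For `1 ≤ n ≤ 10` the sum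
`u + v + w` does not vanish on a nondegenerate triangle.) -/
def center (T : Tri) (n : ℕ) : Plane := Finset.univ.centerMass (bary T n) T.points

/-- `D(i,j)`, the distance between the centers `X_i` and `X_j`. -/
def D (T : Tri) (i j : ℕ) : ℝ := dist (center T i) (center T j)

/-- All values of the ratio `D(n,i)/D(n,j)`, over all triangles for which it is defined. -/
def ratios (n i j : ℕ) : Set ℝ :=
  {r | ∃ T : Tri, D T n j ≠ 0 ∧ r = D T n i / D T n j}

/-- `k` is the best lower bound for `D(n,i)/D(n,j)`: the inequality `k D(n,j) ≤ D(n,i)` holds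
for all triangles, and `k` is the largest lower bound of the ratio. -/
def BestLower (n i j : ℕ) (k : ℝ) : Prop :=
  (∀ T : Tri, k * D T n j ≤ D T n i) ∧ IsGLB (ratios n i j) k

/-- `k` is the best upper bound for `D(n,i)/D(n,j)`: the inequality `D(n,i) ≤ k D(n,j)` holds
for all triangles, and `k` is the smallest upper bound of the ratio. -/
def BestUpper (n i j : ℕ) (k : ℝ) : Prop :=
  (∀ T : Tri, D T n i ≤ k * D T n j) ∧ IsLUB (ratios n i j) k

/-- The best upper bound for `D(n,i)/D(n,j)` is infinite. -/
def NoUpper (n i j : ℕ) : Prop := ¬ BddAbove (ratios n i j)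

open Polynomial in
/-- The polynomial of degree 20 whose largest real root is `C_6`. -/
def polyC6 : ℝ[X] :=
  6967296 * X ^ 20 + 2015974656 * X ^ 18 - 160813808784 * X ^ 16 + 603818269839 * X ^ 14
    - 894980577861 * X ^ 12 + 677249814873 * X ^ 10 - 274035844587 * X ^ 8
    + 60418557684 * X ^ 6 - 6782842860 * X ^ 4 + 290960784 * X ^ 2 + 7744

end TriangleCenters

end

open TriangleCenters

namespace TriangleCenters

/-! Write the sides as `y + z`, `z + x`, `x + y` with positive tangent lengths `x, y, z`, and let
`p, q, w` be their elementary symmetric functions. The barycentric distance formula turns each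
`D(6,n)²` into an explicit fraction `num / den` in `p, q, w`, up to the common factor `4 (p² - q)²`.
A bound `k D(6,i) ≤ l D(6,j)` then becomes nonnegativity of a symmetric polynomial, which may be
tested on sorted triples `x, x + u, x + u + v` with `u, v ≥ 0` (`mul_D_le_mul_D`).

When the extremal triangles are equilateral or degenerate limits, all coefficients of that
polynomial in `x, u, v` are nonnegative. The constants with `√2` and `√3` occur at nondegenerate
isosceles triangles, where the polynomial has a double zero; there it is a visible square times a
nonnegative factor, plus a nonnegative multiple of the squared deviation from being isosceles.
Several other bounds are products of sharp bounds having a common extremal triangle.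

For sharpness, in the isosceles triangle with tangent lengths `1, 1, s` every center lies on the
axis, so the distances are proportional to absolute values of rational functions of `s`. Limits `s →
0`, `∞`, `1`, `√2 - 1`, `√3` give all the constants except two, and also all zero infima and
unbounded ratios. The exception `3/4` for `(2,9)` needs flat triangles that are slightly
non-isosceles.

The other exception, `C₆` for `(3,7)`, is attained at a scalene triangle. Normalizing `p = 1` gives
the two-variable polynomial `ratioF κ q t`, and the best `κ = C₆²` is the one for which `ratioF`
touches zero at an interior critical point. That point is algebraic of high degree: `exists_crit`
describes it by a root of `critPoly`, `ratioF_nonneg_near` proves nonnegativity around it from the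
exact Taylor expansion, and two polynomial certificates cover the remaining region. -/

/-! ### Barycentric distances and tangent lengths. -/

/-- The difference of two normalized barycentric vectors has coordinate sum zero, and a displacement
`(α, β, γ)` of that kind has squared length `-(a²βγ + b²γα + c²αβ)`. The coordinate sums are
multiplied out to avoid division. -/
theorem dist_centerMass_sq (P : Fin 3 → Plane) (u v : Fin 3 → ℝ)
    (hu : u 0 + u 1 + u 2 ≠ 0) (hv : v 0 + v 1 + v 2 ≠ 0) :
    dist (Finset.univ.centerMass u P) (Finset.univ.centerMass v P) ^ 2 *
        ((u 0 + u 1 + u 2) * (v 0 + v 1 + v 2)) ^ 2 =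
      -(dist (P 1) (P 2) ^ 2 *
          (((v 0 + v 1 + v 2) * u 1 - (u 0 + u 1 + u 2) * v 1) *
            ((v 0 + v 1 + v 2) * u 2 - (u 0 + u 1 + u 2) * v 2)) +
        dist (P 2) (P 0) ^ 2 *
          (((v 0 + v 1 + v 2) * u 2 - (u 0 + u 1 + u 2) * v 2) *
            ((v 0 + v 1 + v 2) * u 0 - (u 0 + u 1 + u 2) * v 0)) +
        dist (P 0) (P 1) ^ 2 *
          (((v 0 + v 1 + v 2) * u 0 - (u 0 + u 1 + u 2) * v 0) *
            ((v 0 + v 1 + v 2) * u 1 - (u 0 + u 1 + u 2) * v 1))) := by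
  have hd : ∀ A B : Plane, dist A B ^ 2 = (A 0 - B 0) ^ 2 + (A 1 - B 1) ^ 2 := by
    intro A B
    rw [EuclideanSpace.dist_eq, Real.sq_sqrt (Finset.sum_nonneg fun _ _ => sq_nonneg _),
      Fin.sum_univ_two, Real.dist_eq, Real.dist_eq, sq_abs, sq_abs]
  have key : ∀ k : Fin 2, (Finset.univ.centerMass u P k - Finset.univ.centerMass v P k) *
      ((u 0 + u 1 + u 2) * (v 0 + v 1 + v 2)) =
      (v 0 + v 1 + v 2) * (u 0 * P 0 k + u 1 * P 1 k + u 2 * P 2 k) -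
      (u 0 + u 1 + u 2) * (v 0 * P 0 k + v 1 * P 1 k + v 2 * P 2 k) := by
    intro k
    simp only [Finset.centerMass, Fin.sum_univ_three, PiLp.smul_apply, PiLp.add_apply,
      smul_eq_mul]
    field_simp
  rw [hd, hd, hd, hd, add_mul, ← mul_pow, ← mul_pow, key, key]
  ring

theorem dist_lt_of_tri (T : Tri) {i j k : Fin 3} (hij : i ≠ j) (hjk : j ≠ k) (hik : i ≠ k) :
    dist (T.points i) (T.points k) <
      dist (T.points i) (T.points j) + dist (T.points j) (T.points k) := by
  refine lt_of_le_of_ne (dist_triangle _ _ _) fun h => ?_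
  have hw := (dist_add_dist_eq_iff.1 h.symm).collinear
  exact (affineIndependent_iff_not_collinear_of_ne (k := ℝ) (p := T.points) hij hik hjk).1
    T.independent hw

/-- The tangent lengths of a triangle. -/
theorem exists_ravi (T : Tri) : ∃ x y z : ℝ, 0 < x ∧ 0 < y ∧ 0 < z ∧
    sideA T = y + z ∧ sideB T = z + x ∧ sideC T = x + y := by
  have h0 := dist_lt_of_tri T (i := 1) (j := 0) (k := 2) (by decide) (by decide) (by decide)
  have h1 := dist_lt_of_tri T (i := 2) (j := 1) (k := 0) (by decide) (by decide) (by decide)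
  have h2 := dist_lt_of_tri T (i := 0) (j := 2) (k := 1) (by decide) (by decide) (by decide)
  rw [dist_comm (T.points 1) (T.points 0), dist_comm (T.points 0) (T.points 2)] at h0
  rw [dist_comm (T.points 2) (T.points 1), dist_comm (T.points 1) (T.points 0)] at h1
  rw [dist_comm (T.points 0) (T.points 2), dist_comm (T.points 2) (T.points 1)] at h2
  refine ⟨(sideB T + sideC T - sideA T) / 2, (sideC T + sideA T - sideB T) / 2,
    (sideA T + sideB T - sideC T) / 2, ?_⟩
  simp only [sideA, sideB, sideC]
  refine ⟨?_, ?_, ?_, ?_, ?_, ?_⟩ <;> linarith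

theorem exists_tri {x y z : ℝ} (hx : 0 < x) (hy : 0 < y) (hz : 0 < z) :
    ∃ T : Tri, sideA T = y + z ∧ sideB T = z + x ∧ sideC T = x + y := by
  have hxy : x + y ≠ 0 := by positivity
  -- By Heron's formula `σ` is the area, so the height of `C` over the base `AB` is `2σ / (x + y)`;
  -- the abscissa of `C` comes from the law of cosines.
  obtain ⟨σ, hs⟩ : ∃ σ : ℝ, σ ^ 2 = (x + y + z) * (x * y * z) :=
    ⟨_, Real.sq_sqrt (by positivity)⟩
  set A : Plane := !₂[0, 0]
  set B : Plane := !₂[x + y, 0]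
  set C : Plane := !₂[((z + x) ^ 2 + (x + y) ^ 2 - (y + z) ^ 2) / (2 * (x + y)),
    2 * σ / (x + y)]
  have hd : ∀ A B : Plane, ∀ d : ℝ, 0 ≤ d → (A 0 - B 0) ^ 2 + (A 1 - B 1) ^ 2 = d ^ 2 →
      dist A B = d := by
    intro A B d hd h
    rw [EuclideanSpace.dist_eq, Fin.sum_univ_two, Real.dist_eq, Real.dist_eq, sq_abs, sq_abs, h,
      Real.sqrt_sq hd]
  have hBC : dist B C = y + z := by
    refine hd _ _ _ (by positivity) ?_
    simp only [B, C, Matrix.cons_val_zero, Matrix.cons_val_one]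
    field_simp
    linear_combination 16 * hs
  have hCA : dist C A = z + x := by
    refine hd _ _ _ (by positivity) ?_
    simp only [A, C, Matrix.cons_val_zero, Matrix.cons_val_one]
    field_simp
    linear_combination 16 * hs
  have hAB : dist A B = x + y := by
    refine hd _ _ _ (by positivity) ?_
    simp only [A, B, Matrix.cons_val_zero, Matrix.cons_val_one]
    ring
  have hind : AffineIndependent ℝ ![A, B, C] := by
    rw [affineIndependent_iff_not_collinear_set]
    intro h
    rcases h.wbtw_or_wbtw_or_wbtw with h | h | h
    · have := h.dist_add_dist
      rw [dist_comm A C] at this; linarith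
    · have := h.dist_add_dist
      rw [dist_comm B A] at this; linarith
    · have := h.dist_add_dist
      rw [dist_comm C B] at this; linarith
  exact ⟨⟨![A, B, C], hind⟩, hBC, hCA, hAB⟩

/-! ### Squared distances from the symmedian point as functions of `p, q, w`. -/

/-- Numerator of the squared distance `4 (p² - q)² D(6,n)²`, in the elementary symmetric
functions `p, q, w` of the tangent lengths. -/
def num (n : ℕ) (p q w : ℝ) : ℝ :=
  match n with
  | 1 => p ^ 3 * q ^ 2 + 2 * p ^ 2 * q * w - 4 * p * q ^ 3 - 3 * p * w ^ 2 + 4 * q ^ 2 * w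
  | 2 => 4 * p ^ 6 - 12 * p ^ 4 * q + 48 * p ^ 3 * w - 15 * p ^ 2 * q ^ 2 + 6 * p * q * w - 4 * q ^ 3 - 27 * w ^ 2
  | 3 => p ^ 6 * q ^ 2 - 2 * p ^ 5 * q * w - 2 * p ^ 4 * q ^ 3 + p ^ 4 * w ^ 2 - 8 * p ^ 3 * q ^ 2 * w + p ^ 2 * q ^ 4 + 22 * p ^ 2 * q * w ^ 2 - 2 * p * q ^ 3 * w - 12 * p * w ^ 3 + q ^ 2 * w ^ 2
  | 4 => -4 * p ^ 7 * w + p ^ 6 * q ^ 2 + 10 * p ^ 5 * q * w - 2 * p ^ 4 * q ^ 3 + 17 * p ^ 4 * w ^ 2 - 11 * p ^ 3 * q ^ 2 * w + p ^ 2 * q ^ 4 - 12 * p ^ 2 * q * w ^ 2 + 2 * p * q ^ 3 * w - 3 * p * w ^ 3 + q ^ 2 * w ^ 2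
  | 5 => p ^ 6 * q ^ 2 - 2 * p ^ 5 * q * w - 2 * p ^ 4 * q ^ 3 + 129 * p ^ 4 * w ^ 2 - 44 * p ^ 3 * q ^ 2 * w + p ^ 2 * q ^ 4 - 34 * p ^ 2 * q * w ^ 2 - 2 * p * q ^ 3 * w - 48 * p * w ^ 3 + q ^ 2 * w ^ 2
  | 7 => -12 * p ^ 4 * w ^ 2 + p ^ 2 * q ^ 4 + 36 * p ^ 2 * q * w ^ 2 + 6 * p * q ^ 3 * w - 4 * q ^ 5 - 27 * q ^ 2 * w ^ 2
  | 8 => 4 * p ^ 7 - 20 * p ^ 5 * q + 40 * p ^ 4 * w + 17 * p ^ 3 * q ^ 2 - 50 * p ^ 2 * q * w - 4 * p * q ^ 3 - 3 * p * w ^ 2 + 16 * q ^ 2 * w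
  | 9 => p ^ 6 * q ^ 2 + 2 * p ^ 5 * q * w - 4 * p ^ 4 * q ^ 3 - 3 * p ^ 4 * w ^ 2 + 4 * p ^ 3 * q ^ 2 * w
  | 10 => p ^ 7 - 4 * p ^ 5 * q + 11 * p ^ 4 * w - 6 * p ^ 2 * q * w - 3 * p * w ^ 2 + q ^ 2 * w
  | _ => 0

/-- Denominator of the squared distance `4 (p² - q)² D(6,n)²`. -/
def den (n : ℕ) (p q w : ℝ) : ℝ :=
  match n with
  | 1 => p
  | 2 => 9
  | 3 => 4 * p * w
  | 4 => p * w
  | 5 => 16 * p * w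
  | 7 => q ^ 2
  | 8 => p
  | 9 => q ^ 2
  | 10 => p
  | _ => 1

/-- The indices of the triangle centers other than the symmedian point. -/
def idx : Finset ℕ := {1, 2, 3, 4, 5, 7, 8, 9, 10}

theorem den_pos (n : ℕ) {p q w : ℝ} (hp : 0 < p) (hq : 0 < q) (hw : 0 < w) :
    0 < den n p q w := by
  unfold den
  split <;> positivity

theorem D_sq (T : Tri) {x y z : ℝ} (hx : 0 < x) (hy : 0 < y) (hz : 0 < z)
    (ha : sideA T = y + z) (hb : sideB T = z + x) (hc : sideC T = x + y) {n : ℕ} (hn : n ∈ idx) :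
    4 * ((x + y + z) ^ 2 - (x * y + y * z + z * x)) ^ 2 * D T 6 n ^ 2 *
      den n (x + y + z) (x * y + y * z + z * x) (x * y * z) =
      num n (x + y + z) (x * y + y * z + z * x) (x * y * z) := by
  have hp : 0 < x + y + z := by positivity
  have hq : 0 < x * y + y * z + z * x := by positivity
  have hw : 0 < x * y * z := by positivity
  have h6 : bary T 6 0 + bary T 6 1 + bary T 6 2 =
      2 * ((x + y + z) ^ 2 - (x * y + y * z + z * x)) := by
    simp only [bary, firstCoord, ha, hb, hc, Matrix.cons_val_zero, Matrix.cons_val_one,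
      Matrix.cons_val]
    ring
  have h60 : bary T 6 0 + bary T 6 1 + bary T 6 2 ≠ 0 := by
    have : 0 < (x + y + z) ^ 2 - (x * y + y * z + z * x) := by
      ring_nf
      positivity
    rw [h6]; positivity
  have key : ∀ S : ℝ, bary T n 0 + bary T n 1 + bary T n 2 = S → S ≠ 0 →
      D T 6 n ^ 2 * ((bary T 6 0 + bary T 6 1 + bary T 6 2) * S) ^ 2 =
      -((y + z) ^ 2 *
          ((S * bary T 6 1 - (bary T 6 0 + bary T 6 1 + bary T 6 2) * bary T n 1) *
            (S * bary T 6 2 - (bary T 6 0 + bary T 6 1 + bary T 6 2) * bary T n 2)) +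
        (z + x) ^ 2 *
          ((S * bary T 6 2 - (bary T 6 0 + bary T 6 1 + bary T 6 2) * bary T n 2) *
            (S * bary T 6 0 - (bary T 6 0 + bary T 6 1 + bary T 6 2) * bary T n 0)) +
        (x + y) ^ 2 *
          ((S * bary T 6 0 - (bary T 6 0 + bary T 6 1 + bary T 6 2) * bary T n 0) *
            (S * bary T 6 1 - (bary T 6 0 + bary T 6 1 + bary T 6 2) * bary T n 1))) := by
    rintro S rfl h0
    rw [← ha, ← hb, ← hc]
    exact dist_centerMass_sq T.points (bary T 6) (bary T n) h60 h0
  simp only [idx, Finset.mem_insert, Finset.mem_singleton] at hn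
  rcases hn with rfl | rfl | rfl | rfl | rfl | rfl | rfl | rfl | rfl
  -- In each case the cancelled constant, here `2 (x + y + z)`, is the sum of the barycentric
  -- coordinates of `X_n`. It is a nonzero multiple of a monomial in `p, q, w`, so the distance
  -- formula can be divided by its square.
  · refine mul_left_cancel₀ (pow_ne_zero 2 (a := 2 * (x + y + z)) (mul_ne_zero (by norm_num) hp.ne')) ?_
    have h := key (2 * (x + y + z)) (by
      simp only [bary, firstCoord, ha, hb, hc, Matrix.cons_val_zero, Matrix.cons_val_one,
        Matrix.cons_val]
      ring) (mul_ne_zero (by norm_num) hp.ne')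
    rw [h6] at h
    simp only [bary, firstCoord, ha, hb, hc, Matrix.cons_val_zero, Matrix.cons_val_one,
      Matrix.cons_val] at h
    simp only [num, den]
    linear_combination (x + y + z) * h
  · refine mul_left_cancel₀ (pow_ne_zero 2 (a := 3) (by norm_num)) ?_
    have h := key 3 (by
      simp only [bary, firstCoord, Matrix.cons_val_zero, Matrix.cons_val_one,
        Matrix.cons_val]
      ring) (by norm_num)
    rw [h6] at h
    simp only [bary, firstCoord, ha, hb, hc, Matrix.cons_val_zero, Matrix.cons_val_one,
      Matrix.cons_val] at h
    simp only [num, den]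
    linear_combination 9 * h
  · refine mul_left_cancel₀ (pow_ne_zero 2 (a := -16 * (x + y + z) * (x * y * z)) (mul_ne_zero (mul_ne_zero (by norm_num) hp.ne') hw.ne')) ?_
    have h := key (-16 * (x + y + z) * (x * y * z)) (by
      simp only [bary, firstCoord, ha, hb, hc, Matrix.cons_val_zero, Matrix.cons_val_one,
        Matrix.cons_val]
      ring) (mul_ne_zero (mul_ne_zero (by norm_num) hp.ne') hw.ne')
    rw [h6] at h
    simp only [bary, firstCoord, ha, hb, hc, Matrix.cons_val_zero, Matrix.cons_val_one,
      Matrix.cons_val] at h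
    simp only [num, den]
    linear_combination (4 * (x + y + z) * (x * y * z)) * h
  · refine mul_left_cancel₀ (pow_ne_zero 2 (a := 16 * (x + y + z) * (x * y * z)) (mul_ne_zero (mul_ne_zero (by norm_num) hp.ne') hw.ne')) ?_
    have h := key (16 * (x + y + z) * (x * y * z)) (by
      simp only [bary, firstCoord, ha, hb, hc, Matrix.cons_val_zero, Matrix.cons_val_one,
        Matrix.cons_val]
      ring) (mul_ne_zero (mul_ne_zero (by norm_num) hp.ne') hw.ne')
    rw [h6] at h
    simp only [bary, firstCoord, ha, hb, hc, Matrix.cons_val_zero, Matrix.cons_val_one,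
      Matrix.cons_val] at h
    simp only [num, den]
    linear_combination ((x + y + z) * (x * y * z)) * h
  · refine mul_left_cancel₀ (pow_ne_zero 2 (a := -32 * (x + y + z) * (x * y * z)) (mul_ne_zero (mul_ne_zero (by norm_num) hp.ne') hw.ne')) ?_
    have h := key (-32 * (x + y + z) * (x * y * z)) (by
      simp only [bary, firstCoord, ha, hb, hc, Matrix.cons_val_zero, Matrix.cons_val_one,
        Matrix.cons_val]
      ring) (mul_ne_zero (mul_ne_zero (by norm_num) hp.ne') hw.ne')
    rw [h6] at h
    simp only [bary, firstCoord, ha, hb, hc, Matrix.cons_val_zero, Matrix.cons_val_one,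
      Matrix.cons_val] at h
    simp only [num, den]
    linear_combination (16 * (x + y + z) * (x * y * z)) * h
  · refine mul_left_cancel₀ (pow_ne_zero 2 (a := 4 * (x * y + y * z + z * x)) (mul_ne_zero (by norm_num) hq.ne')) ?_
    have h := key (4 * (x * y + y * z + z * x)) (by
      simp only [bary, firstCoord, ha, hb, hc, Matrix.cons_val_zero, Matrix.cons_val_one,
        Matrix.cons_val]
      ring) (mul_ne_zero (by norm_num) hq.ne')
    rw [h6] at h
    simp only [bary, firstCoord, ha, hb, hc, Matrix.cons_val_zero, Matrix.cons_val_one,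
      Matrix.cons_val] at h
    simp only [num, den]
    linear_combination (x * y + y * z + z * x) ^ 2 * h
  · refine mul_left_cancel₀ (pow_ne_zero 2 (a := -2 * (x + y + z)) (mul_ne_zero (by norm_num) hp.ne')) ?_
    have h := key (-2 * (x + y + z)) (by
      simp only [bary, firstCoord, ha, hb, hc, Matrix.cons_val_zero, Matrix.cons_val_one,
        Matrix.cons_val]
      ring) (mul_ne_zero (by norm_num) hp.ne')
    rw [h6] at h
    simp only [bary, firstCoord, ha, hb, hc, Matrix.cons_val_zero, Matrix.cons_val_one,
      Matrix.cons_val] at h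
    simp only [num, den]
    linear_combination (x + y + z) * h
  · refine mul_left_cancel₀ (pow_ne_zero 2 (a := -4 * (x * y + y * z + z * x)) (mul_ne_zero (by norm_num) hq.ne')) ?_
    have h := key (-4 * (x * y + y * z + z * x)) (by
      simp only [bary, firstCoord, ha, hb, hc, Matrix.cons_val_zero, Matrix.cons_val_one,
        Matrix.cons_val]
      ring) (mul_ne_zero (by norm_num) hq.ne')
    rw [h6] at h
    simp only [bary, firstCoord, ha, hb, hc, Matrix.cons_val_zero, Matrix.cons_val_one,
      Matrix.cons_val] at h
    simp only [num, den]
    linear_combination (x * y + y * z + z * x) ^ 2 * h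
  · refine mul_left_cancel₀ (pow_ne_zero 2 (a := 4 * (x + y + z)) (mul_ne_zero (by norm_num) hp.ne')) ?_
    have h := key (4 * (x + y + z)) (by
      simp only [bary, firstCoord, ha, hb, hc, Matrix.cons_val_zero, Matrix.cons_val_one,
        Matrix.cons_val]
      ring) (mul_ne_zero (by norm_num) hp.ne')
    rw [h6] at h
    simp only [bary, firstCoord, ha, hb, hc, Matrix.cons_val_zero, Matrix.cons_val_one,
      Matrix.cons_val] at h
    simp only [num, den]
    linear_combination (x + y + z) * h

/-! ### Reduction of the bounds to polynomial inequalities. -/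

/-- Symmetric functions of positive reals can be evaluated at a sorted triple. -/
theorem exists_sorted {x y z : ℝ} (hx : 0 < x) (hy : 0 < y) (hz : 0 < z) :
    ∃ t u v : ℝ, 0 < t ∧ 0 ≤ u ∧ 0 ≤ v ∧ x + y + z = t + (t + u) + (t + u + v) ∧
      x * y + y * z + z * x = t * (t + u) + (t + u) * (t + u + v) + (t + u + v) * t ∧
      x * y * z = t * (t + u) * (t + u + v) := by
  rcases le_total x y with h1 | h1 <;> rcases le_total y z with h2 | h2 <;>
    rcases le_total x z with h3 | h3
  · exact ⟨x, y - x, z - y, hx, by linarith, by linarith, by ring, by ring, by ring⟩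
  · exact ⟨x, y - x, z - y, hx, by linarith, by linarith, by ring, by ring, by ring⟩
  · exact ⟨x, z - x, y - z, hx, by linarith, by linarith, by ring, by ring, by ring⟩
  · exact ⟨z, x - z, y - x, hz, by linarith, by linarith, by ring, by ring, by ring⟩
  · exact ⟨y, x - y, z - x, hy, by linarith, by linarith, by ring, by ring, by ring⟩
  · exact ⟨y, z - y, x - z, hy, by linarith, by linarith, by ring, by ring, by ring⟩
  · exact ⟨z, y - z, x - y, hz, by linarith, by linarith, by ring, by ring, by ring⟩
  · exact ⟨z, y - z, x - y, hz, by linarith, by linarith, by ring, by ring, by ring⟩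

/-- Both squared distances carry the same factor `4 (p² - q)²`, so comparing squares amounts to
cross-multiplying `num` and `den`. The sorted form `x, x + u, x + u + v` turns the ordering of the
tangent lengths into sign conditions usable by `positivity`. -/
theorem mul_D_le_mul_D {i j : ℕ} (hi : i ∈ idx) (hj : j ∈ idx) {k l : ℝ} (hl : 0 ≤ l)
    (h : ∀ x u v : ℝ, 0 < x → 0 ≤ u → 0 ≤ v → ∀ p q w : ℝ, p = x + (x + u) + (x + u + v) →
      q = x * (x + u) + (x + u) * (x + u + v) + (x + u + v) * x →
      w = x * (x + u) * (x + u + v) →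
      0 ≤ l ^ 2 * num j p q w * den i p q w - k ^ 2 * num i p q w * den j p q w) (T : Tri) :
    k * D T 6 i ≤ l * D T 6 j := by
  obtain ⟨x, y, z, hx, hy, hz, ha, hb, hc⟩ := exists_ravi T
  have hp : 0 < x + y + z := by positivity
  have hq : 0 < x * y + y * z + z * x := by positivity
  have hw : 0 < x * y * z := by positivity
  have h1 := D_sq T hx hy hz ha hb hc hi
  have h2 := D_sq T hx hy hz ha hb hc hj
  obtain ⟨t, u, v, ht, hu, hv, e1, e2, e3⟩ := exists_sorted hx hy hz
  have h3 := h t u v ht hu hv _ _ _ e1 e2 e3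
  have di := den_pos i hp hq hw
  have dj := den_pos j hp hq hw
  rw [← h1, ← h2] at h3
  have hS : 0 < (x + y + z) ^ 2 - (x * y + y * z + z * x) := by
    ring_nf
    positivity
  refine abs_le_of_sq_le_sq' ?_ (mul_nonneg hl (show 0 ≤ D T 6 j from dist_nonneg)) |>.2
  have hpos : 0 < 4 * ((x + y + z) ^ 2 - (x * y + y * z + z * x)) ^ 2 *
      den i (x + y + z) (x * y + y * z + z * x) (x * y * z) *
      den j (x + y + z) (x * y + y * z + z * x) (x * y * z) := by positivity
  refine le_of_mul_le_mul_left ?_ hpos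
  linarith

/-! ### Bounds whose polynomials have nonnegative coefficients. -/

/-- Here and in the bounds of the same shape below, the extremal configurations are equilateral or
degenerate limits, so they lie on the boundary of the cone `x, u, v ≥ 0`. Expanding the difference
in `x, u, v` leaves only nonnegative coefficients. -/
theorem upper_1_9 (T : Tri) : D T 6 1 ≤ (1/3 : ℝ) * D T 6 9 := by
  rw [← one_mul (D T 6 1)]
  refine mul_D_le_mul_D (by decide) (by decide) (by norm_num) ?_ T
  rintro x u v hx hu hv p q w rfl rfl rfl
  simp only [num, den]
  ring_nf
  positivity

theorem upper_2_3 (T : Tri) : D T 6 2 ≤ (2/3 : ℝ) * D T 6 3 := by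
  rw [← one_mul (D T 6 2)]
  refine mul_D_le_mul_D (by decide) (by decide) (by norm_num) ?_ T
  rintro x u v hx hu hv p q w rfl rfl rfl
  simp only [num, den]
  ring_nf
  positivity

theorem upper_2_9 (T : Tri) : D T 6 2 ≤ (3/4 : ℝ) * D T 6 9 := by
  rw [← one_mul (D T 6 2)]
  refine mul_D_le_mul_D (by decide) (by decide) (by norm_num) ?_ T
  rintro x u v hx hu hv p q w rfl rfl rfl
  simp only [num, den]
  ring_nf
  positivity

theorem upper_7_9 (T : Tri) : D T 6 7 ≤ (1/2 : ℝ) * D T 6 9 := by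
  rw [← one_mul (D T 6 7)]
  refine mul_D_le_mul_D (by decide) (by decide) (by norm_num) ?_ T
  rintro x u v hx hu hv p q w rfl rfl rfl
  simp only [num, den]
  ring_nf
  positivity

theorem upper_8_10 (T : Tri) : D T 6 8 ≤ 2 * D T 6 10 := by
  rw [← one_mul (D T 6 8)]
  refine mul_D_le_mul_D (by decide) (by decide) (by norm_num) ?_ T
  rintro x u v hx hu hv p q w rfl rfl rfl
  simp only [num, den]
  ring_nf
  positivity

theorem upper_9_10 (T : Tri) : D T 6 9 ≤ (8/5 : ℝ) * D T 6 10 := by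
  rw [← one_mul (D T 6 9)]
  refine mul_D_le_mul_D (by decide) (by decide) (by norm_num) ?_ T
  rintro x u v hx hu hv p q w rfl rfl rfl
  simp only [num, den]
  ring_nf
  positivity

theorem lower_1_7 (T : Tri) : (1/2 : ℝ) * D T 6 7 ≤ D T 6 1 := by
  rw [← one_mul (D T 6 1)]
  refine mul_D_le_mul_D (by decide) (by decide) (by norm_num) ?_ T
  rintro x u v hx hu hv p q w rfl rfl rfl
  simp only [num, den]
  ring_nf
  positivity

theorem lower_2_9 (T : Tri) : (1/2 : ℝ) * D T 6 9 ≤ D T 6 2 := by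
  rw [← one_mul (D T 6 2)]
  refine mul_D_le_mul_D (by decide) (by decide) (by norm_num) ?_ T
  rintro x u v hx hu hv p q w rfl rfl rfl
  simp only [num, den]
  ring_nf
  positivity

theorem lower_2_10 (T : Tri) : (2/3 : ℝ) * D T 6 10 ≤ D T 6 2 := by
  rw [← one_mul (D T 6 2)]
  refine mul_D_le_mul_D (by decide) (by decide) (by norm_num) ?_ T
  rintro x u v hx hu hv p q w rfl rfl rfl
  simp only [num, den]
  ring_nf
  positivity

theorem lower_3_4 (T : Tri) : (1/2 : ℝ) * D T 6 4 ≤ D T 6 3 := by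
  rw [← one_mul (D T 6 3)]
  refine mul_D_le_mul_D (by decide) (by decide) (by norm_num) ?_ T
  rintro x u v hx hu hv p q w rfl rfl rfl
  simp only [num, den]
  ring_nf
  positivity

theorem lower_3_5 (T : Tri) : 2 * D T 6 5 ≤ D T 6 3 := by
  rw [← one_mul (D T 6 3)]
  refine mul_D_le_mul_D (by decide) (by decide) (by norm_num) ?_ T
  rintro x u v hx hu hv p q w rfl rfl rfl
  simp only [num, den]
  ring_nf
  positivity

theorem lower_3_9 (T : Tri) : 1 * D T 6 9 ≤ D T 6 3 := by
  rw [← one_mul (D T 6 3)]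
  refine mul_D_le_mul_D (by decide) (by decide) (by norm_num) ?_ T
  rintro x u v hx hu hv p q w rfl rfl rfl
  simp only [num, den]
  ring_nf
  positivity

theorem lower_8_9 (T : Tri) : 1 * D T 6 9 ≤ D T 6 8 := by
  rw [← one_mul (D T 6 8)]
  refine mul_D_le_mul_D (by decide) (by decide) (by norm_num) ?_ T
  rintro x u v hx hu hv p q w rfl rfl rfl
  simp only [num, den]
  ring_nf
  positivity

theorem lower_9_10 (T : Tri) : 1 * D T 6 10 ≤ D T 6 9 := by
  rw [← one_mul (D T 6 9)]
  refine mul_D_le_mul_D (by decide) (by decide) (by norm_num) ?_ T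
  rintro x u v hx hu hv p q w rfl rfl rfl
  simp only [num, den]
  ring_nf
  positivity

/-! ### Bounds obtained by composing two sharp bounds. -/

theorem upper_8_9 (T : Tri) : D T 6 8 ≤ 2 * D T 6 9 := by
  linarith [upper_8_10 T, lower_9_10 T]

theorem upper_7_8 (T : Tri) : D T 6 7 ≤ (1 / 2 : ℝ) * D T 6 8 := by
  linarith [upper_7_9 T, lower_8_9 T]

theorem upper_7_10 (T : Tri) : D T 6 7 ≤ (4 / 5 : ℝ) * D T 6 10 := by
  linarith [upper_7_9 T, upper_9_10 T]

theorem lower_2_7 (T : Tri) : 1 * D T 6 7 ≤ D T 6 2 := by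
  linarith [upper_7_9 T, lower_2_9 T]

theorem lower_2_8 (T : Tri) : (1 / 3 : ℝ) * D T 6 8 ≤ D T 6 2 := by
  linarith [lower_2_10 T, upper_8_10 T]

theorem lower_3_8 (T : Tri) : (1 / 2 : ℝ) * D T 6 8 ≤ D T 6 3 := by
  linarith [lower_3_9 T, upper_8_9 T]

theorem lower_3_10 (T : Tri) : 1 * D T 6 10 ≤ D T 6 3 := by
  linarith [lower_3_9 T, lower_9_10 T]

/-! ### Bounds with equality at nondegenerate isosceles triangles. -/

/-- Equality holds for tangent lengths proportional to `√2 - 1, 1, 1`, so the difference has an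
interior double zero and cannot have nonnegative coefficients. Let `m = u + n` be the mean excess of
the two larger lengths over `x`, with `n` half their difference. By symmetry the difference is even
in `n` for fixed `m`. Its value at `n = 0` is divisible by `m² (m - √2 x)²`, and the rest by `n²`;
both cofactors are visibly nonnegative. The same scheme proves `upper_2_10` and `lower_8_10`. -/
theorem upper_1_2 (T : Tri) : D T 6 1 ≤ (9 - 6 * √2) * D T 6 2 := by
  have hr : √2 ^ 2 = (2 : ℝ) := Real.sq_sqrt (by norm_num)
  have hlo : (7071 / 5000 : ℝ) < √2 := by rw [Real.lt_sqrt (by norm_num)]; norm_num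
  have hhi : √2 < (14143 / 10000 : ℝ) := by rw [Real.sqrt_lt' (by norm_num)]; norm_num
  rw [← one_mul (D T 6 1)]
  refine mul_D_le_mul_D (by decide) (by decide) (by linarith) ?_ T
  rintro x u v hx hu hv p q w rfl rfl rfl
  obtain ⟨n, rfl⟩ : ∃ n, v = 2 * n := ⟨v / 2, by ring⟩
  have hn : 0 ≤ n := by linarith
  -- The coefficients lie in `ℚ(√2)`. Writing them as a positive rational plus a nonnegative
  -- multiple of the small slack `f` lets `positivity` see their signs.
  obtain ⟨f, hf⟩ : ∃ f, f = 14143 / 10000 - √2 := ⟨_, rfl⟩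
  have hf0 : 0 ≤ f := by linarith
  have h : 0 ≤ (u + n) ^ 2 * ((u + n) - √2 * x) ^ 2 *
      ((1008 / 625 + 31104 * f) * x ^ 3 + (3069 / 1250 + 44136 * f) * x ^ 2 * (u + n) +
      (504 / 625 + 15552 * f) * x * (u + n) ^ 2) +
      n ^ 2 *
      ((6048 / 625 + 186624 * f) * x ^ 5 + (164232 / 625 + 902016 * f) * x ^ 4 * u +
      (164232 / 625 + 902016 * f) * x ^ 4 * n + (518562 / 625 + 1537056 * f) * x ^ 3 * u ^ 2 +
      (1037124 / 625 + 3074112 * f) * x ^ 3 * u * n + (679797 / 625 + 1478736 * f) * x ^ 3 * n ^ 2 +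
      (639648 / 625 + 1223424 * f) * x ^ 2 * u ^ 3 +
      (1918944 / 625 + 3670272 * f) * x ^ 2 * u ^ 2 * n +
      (2342916 / 625 + 3561408 * f) * x ^ 2 * u * n ^ 2 +
      (212724 / 125 + 1114560 * f) * x ^ 2 * n ^ 3 + (332037 / 625 + 467856 * f) * x * u ^ 4 +
      (1328148 / 625 + 1871424 * f) * x * u ^ 3 * n +
      (2316204 / 625 + 2737152 * f) * x * u ^ 2 * n ^ 2 +
      (1976112 / 625 + 1731456 * f) * x * u * n ^ 3 + (612936 / 625 + 399168 * f) * x * n ^ 4 +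
      (58518 / 625 + 69984 * f) * u ^ 5 + (58518 / 125 + 349920 * f) * u ^ 4 * n +
      (652176 / 625 + 684288 * f) * u ^ 3 * n ^ 2 + (786168 / 625 + 653184 * f) * u ^ 2 * n ^ 3 +
      (449856 / 625 + 304128 * f) * u * n ^ 4 + (81792 / 625 + 55296 * f) * n ^ 5) := by positivity
  refine h.trans_eq ?_
  subst hf
  simp only [num, den]
  linear_combination
      -(31104 * x ^ 5 * u ^ 2 * √2 - 23256 * x ^ 5 * u ^ 2 + 62208 * x ^ 5 * u * n * √2 - 46512 * x ^ 5 * u * n +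
      31104 * x ^ 5 * n ^ 2 * √2 + 38952 * x ^ 5 * n ^ 2 + 44136 * x ^ 4 * u ^ 3 * √2 - 65880 * x ^ 4 * u ^ 3 +
      132408 * x ^ 4 * u ^ 2 * n * √2 - 197640 * x ^ 4 * u ^ 2 * n + 132408 * x ^ 4 * u * n ^ 2 * √2 +
      103032 * x ^ 4 * u * n ^ 2 + 44136 * x ^ 4 * n ^ 3 * √2 + 234792 * x ^ 4 * n ^ 3 + 15552 * x ^ 3 * u ^ 4 * √2 -
      47916 * x ^ 3 * u ^ 4 + 62208 * x ^ 3 * u ^ 3 * n * √2 - 191664 * x ^ 3 * u ^ 3 * n + 93312 * x ^ 3 * u ^ 2 * n ^ 2 * √2 +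
      224856 * x ^ 3 * u ^ 2 * n ^ 2 + 62208 * x ^ 3 * u * n ^ 3 * √2 + 833040 * x ^ 3 * u * n ^ 3 +
      15552 * x ^ 3 * n ^ 4 * √2 + 444996 * x ^ 3 * n ^ 4 - 1728 * x ^ 2 * u ^ 5 - 8640 * x ^ 2 * u ^ 4 * n +
      390528 * x ^ 2 * u ^ 3 * n ^ 2 + 1206144 * x ^ 2 * u ^ 2 * n ^ 3 + 1178496 * x ^ 2 * u * n ^ 4 +
      369792 * x ^ 2 * n ^ 5 + 5184 * x * u ^ 6 + 31104 * x * u ^ 5 * n + 233712 * x * u ^ 4 * n ^ 2 +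
      727488 * x * u ^ 3 * n ^ 3 + 990144 * x * u ^ 2 * n ^ 4 + 608256 * x * u * n ^ 5 + 138240 * x * n ^ 6 +
      23328 * u ^ 5 * n ^ 2 + 116640 * u ^ 4 * n ^ 3 + 228096 * u ^ 3 * n ^ 4 + 217728 * u ^ 2 * n ^ 5 +
      101376 * u * n ^ 6 + 18432 * n ^ 7) * hr

theorem upper_2_10 (T : Tri) : D T 6 2 ≤ ((1 + √2) / 3) * D T 6 10 := by
  have hr : √2 ^ 2 = (2 : ℝ) := Real.sq_sqrt (by norm_num)
  have hlo : (7071 / 5000 : ℝ) < √2 := by rw [Real.lt_sqrt (by norm_num)]; norm_num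
  have hhi : √2 < (14143 / 10000 : ℝ) := by rw [Real.sqrt_lt' (by norm_num)]; norm_num
  rw [← one_mul (D T 6 2)]
  refine mul_D_le_mul_D (by decide) (by decide) (by linarith) ?_ T
  rintro x u v hx hu hv p q w rfl rfl rfl
  obtain ⟨n, rfl⟩ : ∃ n, v = 2 * n := ⟨v / 2, by ring⟩
  have hn : 0 ≤ n := by linarith
  -- This time the slack is measured from a rational lower bound of `√2`, because `√2` enters the
  -- coefficients with a positive sign.
  obtain ⟨e, he⟩ : ∃ e, e = √2 - 7071 / 5000 := ⟨_, rfl⟩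
  have he0 : 0 ≤ e := by linarith
  have h : 0 ≤ (u + n) ^ 2 * ((u + n) - √2 * x) ^ 2 *
      ((171 / 50 + 100 * e) * x ^ 3 + (12041 / 2500 + 142 * e) * x ^ 2 * (u + n) +
      (171 / 100 + 50 * e) * x * (u + n) ^ 2) +
      n ^ 2 *
      ((513 / 25 + 600 * e) * x ^ 5 + (34254 / 125 + 2960 * e) * x ^ 4 * u +
      (34254 / 125 + 2960 * e) * x ^ 4 * n + (488724 / 625 + 5152 * e) * x ^ 3 * u ^ 2 +
      (977448 / 625 + 10304 * e) * x ^ 3 * u * n + (124446 / 125 + 5040 * e) * x ^ 3 * n ^ 2 +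
      (584346 / 625 + 4208 * e) * x ^ 2 * u ^ 3 + (1753038 / 625 + 12624 * e) * x ^ 2 * u ^ 2 * n +
      (2135331 / 625 + 12488 * e) * x ^ 2 * u * n ^ 2 + (966639 / 625 + 4072 * e) * x ^ 2 * n ^ 3 +
      (1249359 / 2500 + 1658 * e) * x * u ^ 4 + (1249359 / 625 + 6632 * e) * x * u ^ 3 * n +
      (8810163 / 2500 + 9906 * e) * x * u ^ 2 * n ^ 2 +
      (3812727 / 1250 + 6548 * e) * x * u * n ^ 3 + (2518797 / 2500 + 1614 * e) * x * n ^ 4 +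
      (61272 / 625 + 256 * e) * u ^ 5 + (61272 / 125 + 1280 * e) * u ^ 4 * n +
      (140544 / 125 + 2560 * e) * u ^ 3 * n ^ 2 + (176544 / 125 + 2560 * e) * u ^ 2 * n ^ 3 +
      (114272 / 125 + 1280 * e) * u * n ^ 4 + (146272 / 625 + 256 * e) * n ^ 5) := by positivity
  refine h.trans_eq ?_
  subst he
  simp only [num, den]
  linear_combination
      -(-100 * x ^ 5 * u ^ 2 * √2 + 238 * x ^ 5 * u ^ 2 - 200 * x ^ 5 * u * n * √2 + 476 * x ^ 5 * u * n -
      100 * x ^ 5 * n ^ 2 * √2 + 538 * x ^ 5 * n ^ 2 - 142 * x ^ 4 * u ^ 3 * √2 + 676 * x ^ 4 * u ^ 3 -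
      426 * x ^ 4 * u ^ 2 * n * √2 + 2028 * x ^ 4 * u ^ 2 * n - 426 * x ^ 4 * u * n ^ 2 * √2 + 3508 * x ^ 4 * u * n ^ 2 -
      142 * x ^ 4 * n ^ 3 * √2 + 2156 * x ^ 4 * n ^ 3 - 50 * x ^ 3 * u ^ 4 * √2 + 649 * x ^ 3 * u ^ 4 -
      200 * x ^ 3 * u ^ 3 * n * √2 + 2596 * x ^ 3 * u ^ 3 * n - 300 * x ^ 3 * u ^ 2 * n ^ 2 * √2 +
      6470 * x ^ 3 * u ^ 2 * n ^ 2 - 200 * x ^ 3 * u * n ^ 3 * √2 + 7748 * x ^ 3 * u * n ^ 3 - 50 * x ^ 3 * n ^ 4 * √2 +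
      3169 * x ^ 3 * n ^ 4 + 240 * x ^ 2 * u ^ 5 + 1200 * x ^ 2 * u ^ 4 * n + 4504 * x ^ 2 * u ^ 3 * n ^ 2 +
      8712 * x ^ 2 * u ^ 2 * n ^ 3 + 7444 * x ^ 2 * u * n ^ 4 + 2276 * x ^ 2 * n ^ 5 + 25 * x * u ^ 6 +
      150 * x * u ^ 5 * n + 1204 * x * u ^ 4 * n ^ 2 + 3816 * x * u ^ 3 * n ^ 3 + 5328 * x * u ^ 2 * n ^ 4 +
      3424 * x * u * n ^ 5 + 832 * x * n ^ 6 + 128 * u ^ 5 * n ^ 2 + 640 * u ^ 4 * n ^ 3 + 1280 * u ^ 3 * n ^ 4 +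
      1280 * u ^ 2 * n ^ 5 + 640 * u * n ^ 6 + 128 * n ^ 7) * hr

theorem lower_8_10 (T : Tri) : (3 - √2) * D T 6 10 ≤ D T 6 8 := by
  have hr : √2 ^ 2 = (2 : ℝ) := Real.sq_sqrt (by norm_num)
  have hlo : (7071 / 5000 : ℝ) < √2 := by rw [Real.lt_sqrt (by norm_num)]; norm_num
  have hhi : √2 < (14143 / 10000 : ℝ) := by rw [Real.sqrt_lt' (by norm_num)]; norm_num
  rw [← one_mul (D T 6 8)]
  refine mul_D_le_mul_D (by decide) (by decide) zero_le_one ?_ T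
  rintro x u v hx hu hv p q w rfl rfl rfl
  obtain ⟨n, rfl⟩ : ∃ n, v = 2 * n := ⟨v / 2, by ring⟩
  have hn : 0 ≤ n := by linarith
  obtain ⟨e, he⟩ : ∃ e, e = √2 - 7071 / 5000 := ⟨_, rfl⟩
  have he0 : 0 ≤ e := by linarith
  have h : 0 ≤ (u + n) ^ 2 * ((u + n) - √2 * x) ^ 2 *
      ((339 / 50 + 900 * e) * x ^ 4 + (34817 / 2500 + 1854 * e) * x ^ 3 * (u + n) +
      (24153 / 2500 + 1286 * e) * x ^ 2 * (u + n) ^ 2 + (113 / 50 + 300 * e) * x * (u + n) ^ 3) +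
      n ^ 2 *
      ((1017 / 25 + 5400 * e) * x ^ 6 + (71676 / 125 + 30240 * e) * x ^ 5 * u +
      (71676 / 125 + 30240 * e) * x ^ 5 * n + (1206136 / 625 + 64128 * e) * x ^ 4 * u ^ 2 +
      (2412272 / 625 + 128256 * e) * x ^ 4 * u * n + (295538 / 125 + 63120 * e) * x ^ 4 * n ^ 2 +
      (1831458 / 625 + 68784 * e) * x ^ 3 * u ^ 3 +
      (5494374 / 625 + 206352 * e) * x ^ 3 * u ^ 2 * n +
      (6476047 / 625 + 204456 * e) * x ^ 3 * u * n ^ 2 +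
      (2813131 / 625 + 66888 * e) * x ^ 3 * n ^ 3 + (1143707 / 500 + 40170 * e) * x ^ 2 * u ^ 4 +
      (1143707 / 125 + 160680 * e) * x ^ 2 * u ^ 3 * n +
      (39302323 / 2500 + 239826 * e) * x ^ 2 * u ^ 2 * n ^ 2 +
      (16428183 / 1250 + 158292 * e) * x ^ 2 * u * n ^ 3 +
      (10698509 / 2500 + 38958 * e) * x ^ 2 * n ^ 4 + (1120973 / 1250 + 12252 * e) * x * u ^ 5 +
      (1120973 / 250 + 61260 * e) * x * u ^ 4 * n +
      (12581757 / 1250 + 122268 * e) * x * u ^ 3 * n ^ 2 +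
      (15325811 / 1250 + 121764 * e) * x * u ^ 2 * n ^ 3 +
      (9747233 / 1250 + 60492 * e) * x * u * n ^ 4 + (2519287 / 1250 + 11988 * e) * x * n ^ 5 +
      (87632 / 625 + 1536 * e) * u ^ 6 + (525792 / 625 + 9216 * e) * u ^ 5 * n +
      (290896 / 125 + 23040 * e) * u ^ 4 * n ^ 2 + (462528 / 125 + 30720 * e) * u ^ 3 * n ^ 3 +
      (432896 / 125 + 23040 * e) * u ^ 2 * n ^ 4 + (1105792 / 625 + 9216 * e) * u * n ^ 5 +
      (237632 / 625 + 1536 * e) * n ^ 6) := by positivity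
  refine h.trans_eq ?_
  subst he
  simp only [num, den]
  linear_combination
      -(-900 * x ^ 6 * u ^ 2 * √2 + 966 * x ^ 6 * u ^ 2 - 1800 * x ^ 6 * u * n * √2 + 1932 * x ^ 6 * u * n -
      900 * x ^ 6 * n ^ 2 * √2 + 66 * x ^ 6 * n ^ 2 - 1854 * x ^ 5 * u ^ 3 * √2 + 3368 * x ^ 5 * u ^ 3 -
      5562 * x ^ 5 * u ^ 2 * n * √2 + 10104 * x ^ 5 * u ^ 2 * n - 5562 * x ^ 5 * u * n ^ 2 * √2 +
      5064 * x ^ 5 * u * n ^ 2 - 1854 * x ^ 5 * n ^ 3 * √2 - 1672 * x ^ 5 * n ^ 3 - 1286 * x ^ 4 * u ^ 4 * √2 +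
      4069 * x ^ 4 * u ^ 4 - 5144 * x ^ 4 * u ^ 3 * n * √2 + 16276 * x ^ 4 * u ^ 3 * n - 7716 * x ^ 4 * u ^ 2 * n ^ 2 * √2 +
      13726 * x ^ 4 * u ^ 2 * n ^ 2 - 5144 * x ^ 4 * u * n ^ 3 * √2 - 5100 * x ^ 4 * u * n ^ 3 -
      1286 * x ^ 4 * n ^ 4 * √2 - 6451 * x ^ 4 * n ^ 4 - 300 * x ^ 3 * u ^ 5 * √2 + 1982 * x ^ 3 * u ^ 5 -
      1500 * x ^ 3 * u ^ 4 * n * √2 + 9910 * x ^ 3 * u ^ 4 * n - 3000 * x ^ 3 * u ^ 3 * n ^ 2 * √2 +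
      8356 * x ^ 3 * u ^ 3 * n ^ 2 - 3000 * x ^ 3 * u ^ 2 * n ^ 3 * √2 - 14572 * x ^ 3 * u ^ 2 * n ^ 3 -
      1500 * x ^ 3 * u * n ^ 4 * √2 - 24166 * x ^ 3 * u * n ^ 4 - 300 * x ^ 3 * n ^ 5 * √2 - 9166 * x ^ 3 * n ^ 5 +
      245 * x ^ 2 * u ^ 6 + 1470 * x ^ 2 * u ^ 5 * n - 3020 * x ^ 2 * u ^ 4 * n ^ 2 - 21880 * x ^ 2 * u ^ 3 * n ^ 3 -
      36296 * x ^ 2 * u ^ 2 * n ^ 4 - 24912 * x ^ 2 * u * n ^ 5 - 6248 * x ^ 2 * n ^ 6 - 50 * x * u ^ 7 -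
      350 * x * u ^ 6 * n - 3092 * x * u ^ 5 * n ^ 2 - 11960 * x * u ^ 4 * n ^ 3 - 22128 * x * u ^ 3 * n ^ 4 -
      21344 * x * u ^ 2 * n ^ 5 - 10432 * x * u * n ^ 6 - 2048 * x * n ^ 7 - 256 * u ^ 6 * n ^ 2 -
      1536 * u ^ 5 * n ^ 3 - 3840 * u ^ 4 * n ^ 4 - 5120 * u ^ 3 * n ^ 5 - 3840 * u ^ 2 * n ^ 6 -
      1536 * u * n ^ 7 - 256 * n ^ 8) * hr

/-- Equality occurs at tangent lengths `1, 1, √3`, where the two smaller ones coincide. The scheme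
of `upper_1_2` applies with the roles changed: `x + n` is the mean of the two smaller lengths, `n`
is half their difference, and `u + n` is the excess of the largest over that mean. -/
theorem upper_1_3 (T : Tri) : D T 6 1 ≤ (2 - √3) * D T 6 3 := by
  have hr : √3 ^ 2 = (3 : ℝ) := Real.sq_sqrt (by norm_num)
  have hlo : (433 / 250 : ℝ) < √3 := by rw [Real.lt_sqrt (by norm_num)]; norm_num
  have hhi : √3 < (17321 / 10000 : ℝ) := by rw [Real.sqrt_lt' (by norm_num)]; norm_num
  rw [← one_mul (D T 6 1)]
  refine mul_D_le_mul_D (by decide) (by decide) (by linarith) ?_ T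
  -- The two gaps are named in the opposite order from the previous lemmas: `v` is now the gap
  -- between the two smaller lengths.
  rintro x v u hx hv hu p q w rfl rfl rfl
  obtain ⟨n, rfl⟩ : ∃ n, v = 2 * n := ⟨v / 2, by ring⟩
  have hn : 0 ≤ n := by linarith
  obtain ⟨f, hf⟩ : ∃ f, f = 17321 / 10000 - √3 := ⟨_, rfl⟩
  have hf0 : 0 ≤ f := by linarith
  have h : 0 ≤ (x + n) ^ 2 * (u + n) ^ 2 * ((u + n) - (√3 - 1) * (x + n)) ^ 2 *
      ((33258 / 625 + 1632 * f) * (x + n) ^ 5 + (73306 / 625 + 3424 * f) * (x + n) ^ 4 * (u + n) +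
      (120329 / 1250 + 2808 * f) * (x + n) ^ 3 * (u + n) ^ 2 +
      (4506 / 125 + 1120 * f) * (x + n) ^ 2 * (u + n) ^ 3 +
      (7333 / 1250 + 216 * f) * (x + n) * (u + n) ^ 4 + (179 / 625 + 16 * f) * (u + n) ^ 5) +
      n ^ 2 *
      ((52416 / 625 + 36864 * f) * x ^ 9 + (723456 / 625 + 129024 * f) * x ^ 8 * u +
      (47808 / 25 + 460800 * f) * x ^ 8 * n + (2047808 / 625 + 184832 * f) * x ^ 7 * u ^ 2 +
      (9883264 / 625 + 1401856 * f) * x ^ 7 * u * n +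
      (10214816 / 625 + 2526464 * f) * x ^ 7 * n ^ 2 +
      (2629568 / 625 + 143872 * f) * x ^ 6 * u ^ 3 +
      (4444672 / 125 + 1725440 * f) * x ^ 6 * u ^ 2 * n +
      (57689312 / 625 + 6587648 * f) * x ^ 6 * u * n ^ 2 +
      (45945152 / 625 + 7979008 * f) * x ^ 6 * n ^ 3 + (1816072 / 625 + 66688 * f) * x ^ 5 * u ^ 4 +
      (23041696 / 625 + 1129984 * f) * x ^ 5 * u ^ 3 * n +
      (101288632 / 625 + 6828928 * f) * x ^ 5 * u ^ 2 * n ^ 2 +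
      (186477168 / 625 + 17494272 * f) * x ^ 5 * u * n ^ 3 +
      (24598024 / 125 + 16004480 * f) * x ^ 5 * n ^ 4 + (139528 / 125 + 18560 * f) * x ^ 4 * u ^ 5 +
      (2513712 / 125 + 426240 * f) * x ^ 4 * u ^ 4 * n +
      (3278776 / 25 + 3657600 * f) * x ^ 4 * u ^ 3 * n ^ 2 +
      (49885312 / 125 + 14858240 * f) * x ^ 4 * u ^ 2 * n ^ 3 +
      (362793736 / 625 + 28726144 * f) * x ^ 4 * u * n ^ 4 +
      (205460912 / 625 + 21154048 * f) * x ^ 4 * n ^ 5 + (28444 / 125 + 2880 * f) * x ^ 3 * u ^ 6 +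
      (728776 / 125 + 91520 * f) * x ^ 3 * u ^ 5 * n +
      (33635626 / 625 + 1076704 * f) * x ^ 3 * u ^ 4 * n ^ 2 +
      (150451624 / 625 + 6247296 * f) * x ^ 3 * u ^ 3 * n ^ 3 +
      (355685012 / 625 + 19200448 * f) * x ^ 3 * u ^ 2 * n ^ 4 +
      (432407416 / 625 + 29876864 * f) * x ^ 3 * u * n ^ 5 +
      (215051783 / 625 + 18433232 * f) * x ^ 3 * n ^ 6 + (12148 / 625 + 192 * f) * x ^ 2 * u ^ 7 +
      (511696 / 625 + 9984 * f) * x ^ 2 * u ^ 6 * n +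
      (6816254 / 625 + 166816 * f) * x ^ 2 * u ^ 5 * n ^ 2 +
      (43158148 / 625 + 1344192 * f) * x ^ 2 * u ^ 4 * n ^ 3 +
      (5960908 / 25 + 5940800 * f) * x ^ 2 * u ^ 3 * n ^ 4 +
      (291240576 / 625 + 14741504 * f) * x ^ 2 * u ^ 2 * n ^ 5 +
      (306221997 / 625 + 19227888 * f) * x ^ 2 * u * n ^ 6 +
      (27177226 / 125 + 10215520 * f) * x ^ 2 * n ^ 7 + (24296 / 625 + 384 * f) * x * u ^ 7 * n +
      (576732 / 625 + 11328 * f) * x * u ^ 6 * n ^ 2 +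
      (5371428 / 625 + 133312 * f) * x * u ^ 5 * n ^ 3 +
      (26303298 / 625 + 829792 * f) * x * u ^ 4 * n ^ 4 +
      (74737056 / 625 + 2983424 * f) * x * u ^ 3 * n ^ 5 +
      (5016588 / 25 + 6228800 * f) * x * u ^ 2 * n ^ 6 +
      (116671522 / 625 + 7003488 * f) * x * u * n ^ 7 + (9353403 / 125 + 3268560 * f) * x * n ^ 8 +
      (12148 / 625 + 192 * f) * u ^ 7 * n ^ 2 + (207256 / 625 + 4224 * f) * u ^ 6 * n ^ 3 +
      (1501414 / 625 + 39456 * f) * u ^ 5 * n ^ 4 + (6028288 / 625 + 202752 * f) * u ^ 4 * n ^ 5 +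
      (14608708 / 625 + 618432 * f) * u ^ 3 * n ^ 6 +
      (21545656 / 625 + 1117824 * f) * u ^ 2 * n ^ 7 + (18010869 / 625 + 1105776 * f) * u * n ^ 8 +
      (6588756 / 625 + 460224 * f) * n ^ 9) := by positivity
  refine h.trans_eq ?_
  subst hf
  simp only [num, den]
  linear_combination
      -(1632 * x ^ 9 * u ^ 2 * √3 - 3072 * x ^ 9 * u ^ 2 + 3264 * x ^ 9 * u * n * √3 - 6144 * x ^ 9 * u * n +
      1632 * x ^ 9 * n ^ 2 * √3 + 6144 * x ^ 9 * n ^ 2 + 3424 * x ^ 8 * u ^ 3 * √3 - 7456 * x ^ 8 * u ^ 3 +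
      24960 * x ^ 8 * u ^ 2 * n * √3 - 50016 * x ^ 8 * u ^ 2 * n + 39648 * x ^ 8 * u * n ^ 2 * √3 -
      45408 * x ^ 8 * u * n ^ 2 + 18112 * x ^ 8 * n ^ 3 * √3 + 80096 * x ^ 8 * n ^ 3 + 2808 * x ^ 7 * u ^ 4 * √3 -
      6992 * x ^ 7 * u ^ 4 + 38624 * x ^ 7 * u ^ 3 * n * √3 - 87616 * x ^ 7 * u ^ 3 * n + 157776 * x ^ 7 * u ^ 2 * n ^ 2 * √3 -
      285280 * x ^ 7 * u ^ 2 * n ^ 2 + 210912 * x ^ 7 * u * n ^ 3 * √3 - 77632 * x ^ 7 * u * n ^ 3 +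
      88952 * x ^ 7 * n ^ 4 * √3 + 454384 * x ^ 7 * n ^ 4 + 1120 * x ^ 6 * u ^ 5 * √3 - 2984 * x ^ 6 * u ^ 5 +
      25256 * x ^ 6 * u ^ 4 * n * √3 - 63864 * x ^ 6 * u ^ 4 * n + 185696 * x ^ 6 * u ^ 3 * n ^ 2 * √3 -
      398416 * x ^ 6 * u ^ 3 * n ^ 2 + 553840 * x ^ 6 * u ^ 2 * n ^ 3 * √3 - 776496 * x ^ 6 * u ^ 2 * n ^ 3 +
      646016 * x ^ 6 * u * n ^ 4 * √3 + 293816 * x ^ 6 * u * n ^ 4 + 253736 * x ^ 6 * n ^ 5 * √3 +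
      1476008 * x ^ 6 * n ^ 5 + 216 * x ^ 5 * u ^ 6 * √3 - 396 * x ^ 5 * u ^ 6 + 8016 * x ^ 5 * u ^ 5 * n * √3 -
      20280 * x ^ 5 * u ^ 5 * n + 95808 * x ^ 5 * u ^ 4 * n ^ 2 * √3 - 225620 * x ^ 5 * u ^ 4 * n ^ 2 +
      499136 * x ^ 5 * u ^ 3 * n ^ 3 * √3 - 909328 * x ^ 5 * u ^ 3 * n ^ 3 + 1205112 * x ^ 5 * u ^ 2 * n ^ 4 * √3 -
      998420 * x ^ 5 * u ^ 2 * n ^ 4 + 1257264 * x ^ 5 * u * n ^ 5 * √3 + 1667592 * x ^ 5 * u * n ^ 5 +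
      463280 * x ^ 5 * n ^ 6 * √3 + 3031380 * x ^ 5 * n ^ 6 + 16 * x ^ 4 * u ^ 7 * √3 + 116 * x ^ 4 * u ^ 7 +
      1192 * x ^ 4 * u ^ 6 * n * √3 - 1168 * x ^ 4 * u ^ 6 * n + 23616 * x ^ 4 * u ^ 5 * n ^ 2 * √3 -
      49564 * x ^ 4 * u ^ 5 * n ^ 2 + 199040 * x ^ 4 * u ^ 4 * n ^ 3 * √3 - 387600 * x ^ 4 * u ^ 4 * n ^ 3 +
      822960 * x ^ 4 * u ^ 3 * n ^ 4 * √3 - 1069540 * x ^ 4 * u ^ 3 * n ^ 4 + 1698888 * x ^ 4 * u ^ 2 * n ^ 5 * √3 -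
      181456 * x ^ 4 * u ^ 2 * n ^ 5 + 1614016 * x ^ 4 * u * n ^ 6 * √3 + 3627884 * x ^ 4 * u * n ^ 6 +
      561488 * x ^ 4 * n ^ 7 * √3 + 4088176 * x ^ 4 * n ^ 7 + 44 * x ^ 3 * u ^ 8 + 64 * x ^ 3 * u ^ 7 * n * √3 +
      816 * x ^ 3 * u ^ 7 * n + 2608 * x ^ 3 * u ^ 6 * n ^ 2 * √3 + 1240 * x ^ 3 * u ^ 6 * n ^ 2 +
      36704 * x ^ 3 * u ^ 5 * n ^ 3 * √3 - 48352 * x ^ 3 * u ^ 5 * n ^ 3 + 244920 * x ^ 3 * u ^ 4 * n ^ 4 * √3 -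
      314024 * x ^ 3 * u ^ 4 * n ^ 4 + 854304 * x ^ 3 * u ^ 3 * n ^ 5 * √3 - 491888 * x ^ 3 * u ^ 3 * n ^ 5 +
      1559744 * x ^ 3 * u ^ 2 * n ^ 6 * √3 + 1175912 * x ^ 3 * u ^ 2 * n ^ 6 + 1367936 * x ^ 3 * u * n ^ 7 * √3 +
      4403072 * x ^ 3 * u * n ^ 7 + 451736 * x ^ 3 * n ^ 8 * √3 + 3624872 * x ^ 3 * n ^ 8 + 4 * x ^ 2 * u ^ 9 +
      168 * x ^ 2 * u ^ 8 * n + 96 * x ^ 2 * u ^ 7 * n ^ 2 * √3 + 1944 * x ^ 2 * u ^ 7 * n ^ 2 +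
      2832 * x ^ 2 * u ^ 6 * n ^ 3 * √3 + 7440 * x ^ 2 * u ^ 6 * n ^ 3 + 31776 * x ^ 2 * u ^ 5 * n ^ 4 * √3 -
      4304 * x ^ 2 * u ^ 5 * n ^ 4 + 178728 * x ^ 2 * u ^ 4 * n ^ 5 * √3 - 59880 * x ^ 2 * u ^ 4 * n ^ 5 +
      546304 * x ^ 2 * u ^ 3 * n ^ 6 * √3 + 194392 * x ^ 2 * u ^ 3 * n ^ 6 + 902592 * x ^ 2 * u ^ 2 * n ^ 7 * √3 +
      1578944 * x ^ 2 * u ^ 2 * n ^ 7 + 738624 * x ^ 2 * u * n ^ 8 * √3 + 3130560 * x ^ 2 * u * n ^ 8 +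
      232648 * x ^ 2 * n ^ 9 * √3 + 2039800 * x ^ 2 * n ^ 9 + 8 * x * u ^ 9 * n + 204 * x * u ^ 8 * n ^ 2 +
      64 * x * u ^ 7 * n ^ 3 * √3 + 1904 * x * u ^ 7 * n ^ 3 + 1528 * x * u ^ 6 * n ^ 4 * √3 + 8468 * x * u ^ 6 * n ^ 4 +
      14544 * x * u ^ 5 * n ^ 5 * √3 + 21688 * x * u ^ 5 * n ^ 5 + 71696 * x * u ^ 4 * n ^ 6 * √3 +
      65772 * x * u ^ 4 * n ^ 6 + 197056 * x * u ^ 3 * n ^ 7 * √3 + 296096 * x * u ^ 3 * n ^ 7 +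
      299544 * x * u ^ 2 * n ^ 8 * √3 + 861932 * x * u ^ 2 * n ^ 8 + 230704 * x * u * n ^ 9 * √3 +
      1223832 * x * u * n ^ 9 + 69600 * x * n ^ 10 * √3 + 661620 * x * n ^ 10 + 4 * u ^ 9 * n ^ 2 +
      80 * u ^ 8 * n ^ 3 + 16 * u ^ 7 * n ^ 4 * √3 + 660 * u ^ 7 * n ^ 4 + 328 * u ^ 6 * n ^ 5 * √3 +
      3040 * u ^ 6 * n ^ 5 + 2752 * u ^ 5 * n ^ 6 * √3 + 9908 * u ^ 5 * n ^ 6 + 12208 * u ^ 4 * n ^ 7 * √3 +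
      30480 * u ^ 4 * n ^ 7 + 30736 * u ^ 3 * n ^ 8 * √3 + 88284 * u ^ 3 * n ^ 8 + 43528 * u ^ 2 * n ^ 9 * √3 +
      180096 * u ^ 2 * n ^ 9 + 31776 * u * n ^ 10 * √3 + 203868 * u * n ^ 10 + 9216 * n ^ 11 * √3 +
      94320 * n ^ 11) * hr

/-- The bounds for `(2,10)`, `(8,10)` and `(1,2)` are all sharp at the isosceles triangle with `s =
√2 - 1`, so their products lose nothing; `upper_1_8` and `upper_1_10` use the same observation. -/
theorem upper_2_8 (T : Tri) : D T 6 2 ≤ ((5 + 4 * √2) / 21) * D T 6 8 := by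
  have hr : √2 ^ 2 = (2 : ℝ) := Real.sq_sqrt (by norm_num)
  have h := mul_le_mul_of_nonneg_left (lower_8_10 T) (show 0 ≤ (5 + 4 * √2) / 21 by positivity)
  linear_combination upper_2_10 T + h + (4 / 21 * D T 6 10) * hr

theorem upper_1_8 (T : Tri) : D T 6 1 ≤ ((2 * √2 - 1) / 7) * D T 6 8 := by
  have hr : √2 ^ 2 = (2 : ℝ) := Real.sq_sqrt (by norm_num)
  have hhi : √2 < (3 / 2 : ℝ) := by rw [Real.sqrt_lt' (by norm_num)]; norm_num
  have h := mul_le_mul_of_nonneg_left (upper_2_8 T) (show 0 ≤ 9 - 6 * √2 by linarith)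
  linear_combination upper_1_2 T + h - (24 / 21 * D T 6 8) * hr

theorem upper_1_10 (T : Tri) : D T 6 1 ≤ (√2 - 1) * D T 6 10 := by
  have hr : √2 ^ 2 = (2 : ℝ) := Real.sq_sqrt (by norm_num)
  have hhi : √2 < (3 / 2 : ℝ) := by rw [Real.sqrt_lt' (by norm_num)]; norm_num
  have h := mul_le_mul_of_nonneg_left (upper_2_10 T) (show 0 ≤ 9 - 6 * √2 by linarith)
  linear_combination upper_1_2 T + h - (2 * D T 6 10) * hr

/-! ### Sharpness from approximating triangles. -/

/-- There are triangles with `X_i, X_j ≠ X_6` for which the ratio `D(6,i)/D(6,j)` is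
arbitrarily close to `k`. -/
def Approaches (i j : ℕ) (k : ℝ) : Prop :=
  ∀ ε > 0, ∃ T : Tri, D T 6 i ≠ 0 ∧ D T 6 j ≠ 0 ∧ |D T 6 i / D T 6 j - k| < ε

theorem D_pos_of_ne {T : Tri} {i j : ℕ} (h : D T i j ≠ 0) : 0 < D T i j :=
  lt_of_le_of_ne dist_nonneg h.symm

theorem bestLower_of_approaches {i j : ℕ} {k : ℝ} (h : ∀ T : Tri, k * D T 6 j ≤ D T 6 i)
    (ha : Approaches i j k) : BestLower 6 i j k := by
  refine ⟨h, ?_, fun b hb => le_of_forall_pos_lt_add fun ε hε => ?_⟩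
  · rintro _ ⟨T, hT, rfl⟩
    exact (le_div_iff₀ (D_pos_of_ne hT)).2 (h T)
  · obtain ⟨T, -, hT, hk⟩ := ha ε hε
    linarith [hb ⟨T, hT, rfl⟩, (abs_lt.1 hk).2]

theorem bestUpper_of_approaches {i j : ℕ} {k : ℝ} (h : ∀ T : Tri, D T 6 i ≤ k * D T 6 j)
    (ha : Approaches i j k) : BestUpper 6 i j k := by
  refine ⟨h, ?_, fun b hb => le_of_forall_pos_lt_add fun ε hε => ?_⟩
  · rintro _ ⟨T, hT, rfl⟩
    exact (div_le_iff₀ (D_pos_of_ne hT)).2 (h T)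
  · obtain ⟨T, -, hT, hk⟩ := ha ε hε
    linarith [hb ⟨T, hT, rfl⟩, (abs_lt.1 hk).1]

theorem bestLower_zero_of_approaches {i j : ℕ} (ha : Approaches i j 0) : BestLower 6 i j 0 :=
  bestLower_of_approaches (fun T => by rw [zero_mul]; exact dist_nonneg) ha

/-- Since `Approaches` requires both distances to be nonzero, a ratio tending to `0` can be
inverted, and the inverse is unbounded. -/
theorem noUpper_of_approaches {i j : ℕ} (ha : Approaches j i 0) : NoUpper 6 i j := by
  rintro ⟨b, hb⟩
  obtain ⟨T, hj, hi, hk⟩ := ha (1 / (|b| + 1)) (by positivity)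
  have hjp := D_pos_of_ne hj
  have hip := D_pos_of_ne hi
  have h1 := hb ⟨T, hj, rfl⟩
  rw [sub_zero, abs_of_pos (by positivity), div_lt_div_iff₀ hip (by positivity)] at hk
  rw [div_le_iff₀ hjp] at h1
  nlinarith [le_abs_self b]

/-! ### The family of isosceles triangles. -/

/-- In the isosceles triangle with tangent lengths `1, 1, s` the distances `D(6,n)` are
proportional to `|g n s|`. -/
noncomputable def g (n : ℕ) (s : ℝ) : ℝ :=
  match n with
  | 1 => (1 + s) / (s + 2)
  | 2 => (3 + s) / 3
  | 3 => (1 + s) ^ 2 * (3 + s) / (2 * s * (s + 2))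
  | 4 => -(3 + s) / (s * (s + 2))
  | 5 => (3 + s) * (s ^ 2 + 2 * s - 1) / (4 * s * (s + 2))
  | 7 => (s - 1) / (1 + 2 * s)
  | 8 => (s ^ 2 + 3 * s + 4) / (s + 2)
  | 9 => (s + 1) * (s + 2) / (1 + 2 * s)
  | 10 => (s ^ 2 + 4 * s + 5) / (2 * (s + 2))
  | _ => 0

theorem exists_isosceles {s : ℝ} (hs : 0 < s) (h1 : s ≠ 1) :
    ∃ T : Tri, ∃ C : ℝ, 0 < C ∧ ∀ n ∈ idx, D T 6 n = C * |g n s| := by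
  obtain ⟨T, ha, hb, hc⟩ := exists_tri one_pos one_pos hs
  -- The common factor is the height `√(s² + 2s)` over the base of length `2`, times `|s - 1|`,
  -- divided by `p² - q = s² + 2s + 3`. The factor `|s - 1|` reflects that all centers coincide in
  -- the equilateral triangle.
  have hC : 0 < √(s ^ 2 + 2 * s) * |s - 1| / (s ^ 2 + 2 * s + 3) :=
    div_pos (mul_pos (Real.sqrt_pos.2 (by positivity)) (abs_pos.2 (sub_ne_zero.2 h1)))
      (by positivity)
  refine ⟨T, _, hC, fun n hn => ?_⟩
  refine (sq_eq_sq₀ dist_nonneg (by positivity)).1 ?_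
  have h := D_sq T one_pos one_pos hs ha hb hc hn
  have e1 : (1 + 1 + s) ^ 2 - (1 * 1 + 1 * s + s * 1) = s ^ 2 + 2 * s + 3 := by ring
  rw [e1] at h
  rw [mul_pow, div_pow, mul_pow, Real.sq_sqrt (by positivity), sq_abs, sq_abs]
  have hd := den_pos n (p := 1 + 1 + s) (q := 1 * 1 + 1 * s + s * 1) (w := 1 * 1 * s)
    (by positivity) (by positivity) (by positivity)
  have hpos : 0 < 4 * (s ^ 2 + 2 * s + 3) ^ 2 *
    den n (1 + 1 + s) (1 * 1 + 1 * s + s * 1) (1 * 1 * s) := by positivity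
  refine mul_left_cancel₀ hpos.ne' ?_
  have key : num n (1 + 1 + s) (1 * 1 + 1 * s + s * 1) (1 * 1 * s) =
      4 * ((s ^ 2 + 2 * s) * (s - 1) ^ 2 * g n s ^ 2) *
        den n (1 + 1 + s) (1 * 1 + 1 * s + s * 1) (1 * 1 * s) := by
    simp only [idx, Finset.mem_insert, Finset.mem_singleton] at hn
    rcases hn with rfl | rfl | rfl | rfl | rfl | rfl | rfl | rfl | rfl <;>
      simp only [num, den, g] <;> field_simp <;> ring
  change _ * D T 6 n ^ 2 = _
  rw [mul_right_comm, h, key]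
  field_simp

/-- The two excluded values are the zeros of `g` on positive `s`: the nine-point center meets the
symmedian point at `s = √2 - 1`, and `g 7` vanishes at `s = 1`. -/
theorem g_ne_zero {s : ℝ} (hs : 0 < s) (h1 : s ≠ 1) (h2 : s ^ 2 + 2 * s - 1 ≠ 0) {n : ℕ}
    (hn : n ∈ idx) : g n s ≠ 0 := by
  have h1' := sub_ne_zero.2 h1
  simp only [idx, Finset.mem_insert, Finset.mem_singleton] at hn
  rcases hn with rfl | rfl | rfl | rfl | rfl | rfl | rfl | rfl | rfl <;> simp only [g]
  case inr.inr.inr.inl => exact div_ne_zero (neg_ne_zero.2 (by positivity)) (by positivity)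
  all_goals positivity

open Filter Topology in
-- `N / M` is the ratio `g i / g j` with denominators cleared, so that it extends continuously to
-- the limiting parameter even where the triangle degenerates. The reparametrization `σ` allows `s →
-- ∞`, and the sign `c` makes the limit nonnegative. One-sided neighbourhoods avoid the exceptional
-- values `1` and `√2 - 1` when these are the limit itself.
theorem approaches_of_isosceles {i j : ℕ} (hi : i ∈ idx) (hj : j ∈ idx) {k : ℝ} (hk : 0 ≤ k)
    (σ N M : ℝ → ℝ) (τ₀ : ℝ) (hN : Continuous N) (hM : Continuous M) (h0 : M τ₀ ≠ 0)
    (hv : N τ₀ = k * M τ₀) {c : ℝ} (hc : |c| = 1)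
    (h : ∀ᶠ τ in 𝓝[>] τ₀, (0 < σ τ ∧ σ τ ≠ 1 ∧ σ τ ^ 2 + 2 * σ τ - 1 ≠ 0) ∧
      g i (σ τ) * M τ = c * (N τ * g j (σ τ))) : Approaches i j k := by
  intro ε hε
  have hlim : Tendsto (fun τ => |N τ / M τ|) (𝓝[>] τ₀) (𝓝 k) := by
    have h2 : Tendsto (fun τ => |N τ / M τ|) (𝓝 τ₀) (𝓝 |N τ₀ / M τ₀|) :=
      (hN.continuousAt.div hM.continuousAt h0).abs
    rw [hv, mul_div_cancel_right₀ _ h0, abs_of_nonneg hk] at h2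
    exact h2.mono_left nhdsWithin_le_nhds
  have hM' : ∀ᶠ τ in 𝓝[>] τ₀, M τ ≠ 0 :=
    (hM.continuousAt.eventually_ne h0).filter_mono nhdsWithin_le_nhds
  obtain ⟨τ, ⟨⟨hs, hs1, hs2⟩, he⟩, hM0, hl⟩ :=
    (h.and (hM'.and (Metric.tendsto_nhds.1 hlim ε hε))).exists
  obtain ⟨T, C, hC, hT⟩ := exists_isosceles hs hs1
  have gi := g_ne_zero hs hs1 hs2 hi
  have gj := g_ne_zero hs hs1 hs2 hj
  refine ⟨T, ?_, ?_, ?_⟩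
  · rw [hT i hi]; exact mul_ne_zero hC.ne' (abs_ne_zero.2 gi)
  · rw [hT j hj]; exact mul_ne_zero hC.ne' (abs_ne_zero.2 gj)
  · rw [hT i hi, hT j hj, mul_div_mul_left _ _ hC.ne', ← abs_div]
    rw [Real.dist_eq] at hl
    rw [← mul_assoc] at he
    rwa [(div_eq_div_iff gj hM0).2 he, mul_div_assoc, abs_mul, hc, one_mul]

theorem sqrt_two_sub_one_pos : 0 < √2 - 1 := by
  have : (1 : ℝ) < √2 := by rw [Real.lt_sqrt (by norm_num)]; norm_num
  linarith

theorem approaches_zero {i j : ℕ} (hi : i ∈ idx) (hj : j ∈ idx) {k : ℝ} (N M : ℝ → ℝ)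
    (hN : Continuous N) (hM : Continuous M) (hk : 0 ≤ k) (h0 : M 0 ≠ 0)
    (hv : N 0 = k * M 0) {c : ℝ} (hc : |c| = 1)
    (h : ∀ τ > 0, g i τ * M τ = c * (N τ * g j τ)) :
    Approaches i j k := by
  refine approaches_of_isosceles hi hj hk (fun τ => τ) N M 0 hN hM h0 hv hc ?_
  filter_upwards [Ioo_mem_nhdsGT (show (0 : ℝ) < 1 / 10 by norm_num)] with τ hτ
  refine ⟨⟨hτ.1, by linarith [hτ.2], ?_⟩, h τ hτ.1⟩
  nlinarith [hτ.1, hτ.2]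

theorem approaches_atTop {i j : ℕ} (hi : i ∈ idx) (hj : j ∈ idx) {k : ℝ} (N M : ℝ → ℝ)
    (hN : Continuous N) (hM : Continuous M) (hk : 0 ≤ k) (h0 : M 0 ≠ 0)
    (hv : N 0 = k * M 0) {c : ℝ} (hc : |c| = 1)
    (h : ∀ τ > 0, g i τ⁻¹ * M τ = c * (N τ * g j τ⁻¹)) :
    Approaches i j k := by
  refine approaches_of_isosceles hi hj hk (fun τ => τ⁻¹) N M 0 hN hM h0 hv hc ?_
  filter_upwards [Ioo_mem_nhdsGT (show (0 : ℝ) < 1 / 10 by norm_num)] with τ hτ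
  have h1 : 1 < τ⁻¹ := (one_lt_inv₀ hτ.1).2 (by linarith [hτ.2])
  refine ⟨⟨by linarith, by linarith, ?_⟩, h τ hτ.1⟩
  nlinarith

theorem approaches_one {i j : ℕ} (hi : i ∈ idx) (hj : j ∈ idx) {k : ℝ} (N M : ℝ → ℝ)
    (hN : Continuous N) (hM : Continuous M) (hk : 0 ≤ k) (h0 : M 1 ≠ 0)
    (hv : N 1 = k * M 1) {c : ℝ} (hc : |c| = 1)
    (h : ∀ τ > 0, g i τ * M τ = c * (N τ * g j τ)) :
    Approaches i j k := by
  refine approaches_of_isosceles hi hj hk (fun τ => τ) N M 1 hN hM h0 hv hc ?_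
  filter_upwards [self_mem_nhdsWithin] with τ hτ
  rw [Set.mem_Ioi] at hτ
  refine ⟨⟨by linarith, by linarith, ?_⟩, h τ (by linarith)⟩
  nlinarith

theorem approaches_sqrt_three {i j : ℕ} (hi : i ∈ idx) (hj : j ∈ idx) {k : ℝ} (N M : ℝ → ℝ)
    (hN : Continuous N) (hM : Continuous M) (hk : 0 ≤ k) (h0 : M (√3) ≠ 0)
    (hv : N (√3) = k * M (√3)) {c : ℝ} (hc : |c| = 1)
    (h : ∀ τ > 0, g i τ * M τ = c * (N τ * g j τ)) :
    Approaches i j k := by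
  have h3 : (1 : ℝ) < √3 := by rw [Real.lt_sqrt (by norm_num)]; norm_num
  refine approaches_of_isosceles hi hj hk (fun τ => τ) N M (√3) hN hM h0 hv hc ?_
  filter_upwards [self_mem_nhdsWithin] with τ hτ
  rw [Set.mem_Ioi] at hτ
  refine ⟨⟨by linarith, by linarith, ?_⟩, h τ (by linarith)⟩
  nlinarith

theorem approaches_sqrt_two {i j : ℕ} (hi : i ∈ idx) (hj : j ∈ idx) {k : ℝ} (N M : ℝ → ℝ)
    (hN : Continuous N) (hM : Continuous M) (hk : 0 ≤ k) (h0 : M (√2 - 1) ≠ 0)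
    (hv : N (√2 - 1) = k * M (√2 - 1)) {c : ℝ} (hc : |c| = 1)
    (h : ∀ τ > 0, g i τ * M τ = c * (N τ * g j τ)) :
    Approaches i j k := by
  have h2 : √2 < (2 : ℝ) := by rw [Real.sqrt_lt' (by norm_num)]; norm_num
  have hr : √2 ^ 2 = (2 : ℝ) := Real.sq_sqrt (by norm_num)
  refine approaches_of_isosceles hi hj hk (fun τ => τ) N M (√2 - 1) hN hM h0 hv hc ?_
  filter_upwards [Ioo_mem_nhdsGT (show √2 - 1 < 1 by linarith)] with τ hτ
  refine ⟨⟨by linarith [hτ.1, sqrt_two_sub_one_pos], by linarith [hτ.2], ?_⟩,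
    h τ (by linarith [hτ.1, sqrt_two_sub_one_pos])⟩
  nlinarith [hτ.1, sqrt_two_sub_one_pos]

/-! ### Limits of the isosceles ratios, pair by pair. -/

theorem approaches_lower_1_2 : Approaches 1 2 0 := by
  refine approaches_atTop (by decide) (by decide) (fun τ => 3 * (τ + 1) * τ) (fun τ => (2 * τ + 1) * (3 * τ + 1))
    (by fun_prop) (by fun_prop) (by norm_num) (by norm_num) (by norm_num) (c := 1) (by norm_num) ?_
  intro τ hτ
  simp only [g]
  field_simp
  ring

theorem approaches_upper_1_2 : Approaches 1 2 (9 - 6 * √2) := by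
  have hr : √2 ^ 2 = (2 : ℝ) := Real.sq_sqrt (by norm_num)
  have hb : √2 < (3 / 2 : ℝ) := by rw [Real.sqrt_lt' (by norm_num)]; norm_num
  refine approaches_sqrt_two (by decide) (by decide) (fun τ => 3 * (τ + 1)) (fun τ => (τ + 2) * (τ + 3))
    (by fun_prop) (by fun_prop) (by linarith) ?_ (by linear_combination (6 * √2 + 9) * hr) (c := 1) (by norm_num) ?_
  · have := sqrt_two_sub_one_pos
    positivity
  intro τ hτ
  simp only [g]
  field_simp
  ring

theorem approaches_lower_1_3 : Approaches 1 3 0 := by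
  refine approaches_zero (by decide) (by decide) (fun τ => 2 * τ) (fun τ => (τ + 1) * (τ + 3))
    (by fun_prop) (by fun_prop) (by norm_num) (by norm_num) (by norm_num) (c := 1) (by norm_num) ?_
  intro τ hτ
  simp only [g]
  field_simp
  ring

theorem approaches_upper_1_3 : Approaches 1 3 (2 - √3) := by
  have hr : √3 ^ 2 = (3 : ℝ) := Real.sq_sqrt (by norm_num)
  have hb : √3 < (2 : ℝ) := by rw [Real.sqrt_lt' (by norm_num)]; norm_num
  refine approaches_sqrt_three (by decide) (by decide) (fun τ => 2 * τ) (fun τ => (τ + 1) * (τ + 3))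
    (by fun_prop) (by fun_prop) (by linarith) ?_ (by linear_combination (√3 + 2) * hr) (c := 1) (by norm_num) ?_
  · positivity
  intro τ hτ
  simp only [g]
  field_simp
  ring

theorem approaches_lower_1_4 : Approaches 1 4 0 := by
  refine approaches_zero (by decide) (by decide) (fun τ => -((τ + 1) * τ)) (fun τ => (τ + 3))
    (by fun_prop) (by fun_prop) (by norm_num) (by norm_num) (by norm_num) (c := 1) (by norm_num) ?_
  intro τ hτ
  simp only [g]
  field_simp
  ring

theorem approaches_inv_1_4 : Approaches 4 1 0 := by
  refine approaches_atTop (by decide) (by decide) (fun τ => -((3 * τ + 1) * τ)) (fun τ => (τ + 1))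
    (by fun_prop) (by fun_prop) (by norm_num) (by norm_num) (by norm_num) (c := 1) (by norm_num) ?_
  intro τ hτ
  simp only [g]
  field_simp

theorem approaches_lower_1_5 : Approaches 1 5 0 := by
  refine approaches_zero (by decide) (by decide) (fun τ => 4 * (τ + 1) * τ) (fun τ => (τ + 3) * (τ ^ 2 + 2 * τ - 1))
    (by fun_prop) (by fun_prop) (by norm_num) (by norm_num) (by norm_num) (c := 1) (by norm_num) ?_
  intro τ hτ
  simp only [g]
  field_simp
  ring

/-- At `s = √2 - 1` the nine-point center coincides with the symmedian point while the other centers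
do not, which sends every ratio with `D(6,5)` in the numerator to `0`. -/
theorem approaches_inv_1_5 : Approaches 5 1 0 := by
  have hr : √2 ^ 2 = (2 : ℝ) := Real.sq_sqrt (by norm_num)
  refine approaches_sqrt_two (by decide) (by decide) (fun τ => (τ + 3) * (τ ^ 2 + 2 * τ - 1)) (fun τ => 4 * τ * (τ + 1))
    (by fun_prop) (by fun_prop) (by norm_num) ?_ (by linear_combination (√2 + 2) * hr) (c := 1) (by norm_num) ?_
  · have := sqrt_two_sub_one_pos
    positivity
  intro τ hτ
  simp only [g]
  field_simp
  ring

theorem approaches_lower_1_7 : Approaches 1 7 (1 / 2) := by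
  refine approaches_zero (by decide) (by decide) (fun τ => -((τ + 1) * (2 * τ + 1))) (fun τ => (τ + 2) * (τ - 1))
    (by fun_prop) (by fun_prop) (by norm_num) (by norm_num) (by norm_num) (c := -1) (by norm_num) ?_
  intro τ hτ
  simp only [g]
  field_simp
  ring

/-- Near the equilateral triangle all distances vanish to first order in `s - 1`, except that of the
Gergonne point, which vanishes to second order. -/
theorem approaches_inv_1_7 : Approaches 7 1 0 := by
  refine approaches_one (by decide) (by decide) (fun τ => (τ - 1) * (τ + 2)) (fun τ => (2 * τ + 1) * (τ + 1))
    (by fun_prop) (by fun_prop) (by norm_num) (by norm_num) (by norm_num) (c := 1) (by norm_num) ?_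
  intro τ hτ
  simp only [g]
  field_simp
  ring

theorem approaches_lower_1_8 : Approaches 1 8 0 := by
  refine approaches_atTop (by decide) (by decide) (fun τ => (τ + 1) * τ) (fun τ => (4 * τ ^ 2 + 3 * τ + 1))
    (by fun_prop) (by fun_prop) (by norm_num) (by norm_num) (by norm_num) (c := 1) (by norm_num) ?_
  intro τ hτ
  simp only [g]
  field_simp
  ring

theorem approaches_upper_1_8 : Approaches 1 8 ((2 * √2 - 1) / 7) := by
  have hr : √2 ^ 2 = (2 : ℝ) := Real.sq_sqrt (by norm_num)
  have hb : (1 : ℝ) < √2 := by rw [Real.lt_sqrt (by norm_num)]; norm_num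
  refine approaches_sqrt_two (by decide) (by decide) (fun τ => (τ + 1)) (fun τ => (τ ^ 2 + 3 * τ + 4))
    (by fun_prop) (by fun_prop) (by linarith) ?_ (by linear_combination (-2 / 7 * √2 - 1 / 7) * hr) (c := 1) (by norm_num) ?_
  · have := sqrt_two_sub_one_pos
    positivity
  intro τ hτ
  simp only [g]
  field_simp
  ring

theorem approaches_lower_1_9 : Approaches 1 9 0 := by
  refine approaches_atTop (by decide) (by decide) (fun τ => (τ + 2) * τ) (fun τ => (2 * τ + 1) * (2 * τ + 1))
    (by fun_prop) (by fun_prop) (by norm_num) (by norm_num) (by norm_num) (c := 1) (by norm_num) ?_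
  intro τ hτ
  simp only [g]
  field_simp
  ring

theorem approaches_upper_1_9 : Approaches 1 9 (1 / 3) := by
  refine approaches_one (by decide) (by decide) (fun τ => (2 * τ + 1)) (fun τ => (τ + 2) * (τ + 2))
    (by fun_prop) (by fun_prop) (by norm_num) (by norm_num) (by norm_num) (c := 1) (by norm_num) ?_
  intro τ hτ
  simp only [g]
  field_simp
  ring

theorem approaches_lower_1_10 : Approaches 1 10 0 := by
  refine approaches_atTop (by decide) (by decide) (fun τ => 2 * (τ + 1) * τ) (fun τ => (5 * τ ^ 2 + 4 * τ + 1))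
    (by fun_prop) (by fun_prop) (by norm_num) (by norm_num) (by norm_num) (c := 1) (by norm_num) ?_
  intro τ hτ
  simp only [g]
  field_simp
  ring

theorem approaches_upper_1_10 : Approaches 1 10 (√2 - 1) := by
  have hr : √2 ^ 2 = (2 : ℝ) := Real.sq_sqrt (by norm_num)
  have hb : (1 : ℝ) < √2 := by rw [Real.lt_sqrt (by norm_num)]; norm_num
  refine approaches_sqrt_two (by decide) (by decide) (fun τ => 2 * (τ + 1)) (fun τ => (τ ^ 2 + 4 * τ + 5))
    (by fun_prop) (by fun_prop) (by linarith) ?_ (by linear_combination (-√2 - 1) * hr) (c := 1) (by norm_num) ?_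
  · have := sqrt_two_sub_one_pos
    positivity
  intro τ hτ
  simp only [g]
  field_simp
  ring

theorem approaches_lower_2_3 : Approaches 2 3 0 := by
  refine approaches_zero (by decide) (by decide) (fun τ => 2 * τ * (τ + 2)) (fun τ => 3 * (τ + 1) * (τ + 1))
    (by fun_prop) (by fun_prop) (by norm_num) (by norm_num) (by norm_num) (c := 1) (by norm_num) ?_
  intro τ hτ
  simp only [g]
  field_simp
  ring

theorem approaches_upper_2_3 : Approaches 2 3 (2 / 3) := by
  refine approaches_atTop (by decide) (by decide) (fun τ => 2 * (2 * τ + 1)) (fun τ => 3 * (τ + 1) * (τ + 1))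
    (by fun_prop) (by fun_prop) (by norm_num) (by norm_num) (by norm_num) (c := 1) (by norm_num) ?_
  intro τ hτ
  simp only [g]
  field_simp
  ring

theorem approaches_lower_2_4 : Approaches 2 4 0 := by
  refine approaches_zero (by decide) (by decide) (fun τ => -(τ * (τ + 2))) (fun τ => 3)
    (by fun_prop) (by fun_prop) (by norm_num) (by norm_num) (by norm_num) (c := 1) (by norm_num) ?_
  intro τ hτ
  simp only [g]
  field_simp

theorem approaches_inv_2_4 : Approaches 4 2 0 := by
  refine approaches_atTop (by decide) (by decide) (fun τ => -(3 * τ * τ)) (fun τ => (2 * τ + 1))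
    (by fun_prop) (by fun_prop) (by norm_num) (by norm_num) (by norm_num) (c := 1) (by norm_num) ?_
  intro τ hτ
  simp only [g]
  field_simp
  ring

theorem approaches_lower_2_5 : Approaches 2 5 0 := by
  refine approaches_zero (by decide) (by decide) (fun τ => 4 * τ * (τ + 2)) (fun τ => 3 * (τ ^ 2 + 2 * τ - 1))
    (by fun_prop) (by fun_prop) (by norm_num) (by norm_num) (by norm_num) (c := 1) (by norm_num) ?_
  intro τ hτ
  simp only [g]
  field_simp

theorem approaches_inv_2_5 : Approaches 5 2 0 := by
  have hr : √2 ^ 2 = (2 : ℝ) := Real.sq_sqrt (by norm_num)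
  refine approaches_sqrt_two (by decide) (by decide) (fun τ => 3 * (τ ^ 2 + 2 * τ - 1)) (fun τ => 4 * τ * (τ + 2))
    (by fun_prop) (by fun_prop) (by norm_num) ?_ (by linear_combination (3) * hr) (c := 1) (by norm_num) ?_
  · have := sqrt_two_sub_one_pos
    positivity
  intro τ hτ
  simp only [g]
  field_simp

theorem approaches_lower_2_7 : Approaches 2 7 1 := by
  refine approaches_zero (by decide) (by decide) (fun τ => -((τ + 3) * (2 * τ + 1))) (fun τ => 3 * (τ - 1))
    (by fun_prop) (by fun_prop) (by norm_num) (by norm_num) (by norm_num) (c := -1) (by norm_num) ?_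
  intro τ hτ
  simp only [g]
  field_simp
  ring

theorem approaches_inv_2_7 : Approaches 7 2 0 := by
  refine approaches_atTop (by decide) (by decide) (fun τ => 3 * (-τ + 1) * τ) (fun τ => (τ + 2) * (3 * τ + 1))
    (by fun_prop) (by fun_prop) (by norm_num) (by norm_num) (by norm_num) (c := 1) (by norm_num) ?_
  intro τ hτ
  simp only [g]
  field_simp
  ring

theorem approaches_lower_2_8 : Approaches 2 8 (1 / 3) := by
  refine approaches_atTop (by decide) (by decide) (fun τ => (3 * τ + 1) * (2 * τ + 1)) (fun τ => 3 * (4 * τ ^ 2 + 3 * τ + 1))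
    (by fun_prop) (by fun_prop) (by norm_num) (by norm_num) (by norm_num) (c := 1) (by norm_num) ?_
  intro τ hτ
  simp only [g]
  field_simp
  ring

theorem approaches_upper_2_8 : Approaches 2 8 ((5 + 4 * √2) / 21) := by
  have hr : √2 ^ 2 = (2 : ℝ) := Real.sq_sqrt (by norm_num)
  refine approaches_sqrt_two (by decide) (by decide) (fun τ => (τ + 3) * (τ + 2)) (fun τ => 3 * (τ ^ 2 + 3 * τ + 4))
    (by fun_prop) (by fun_prop) (by positivity) ?_ (by linear_combination (-4 / 7 * √2 - 2 / 7) * hr) (c := 1) (by norm_num) ?_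
  · have := sqrt_two_sub_one_pos
    positivity
  intro τ hτ
  simp only [g]
  field_simp
  ring

theorem approaches_lower_2_9 : Approaches 2 9 (1 / 2) := by
  refine approaches_zero (by decide) (by decide) (fun τ => (τ + 3) * (2 * τ + 1)) (fun τ => 3 * (τ + 1) * (τ + 2))
    (by fun_prop) (by fun_prop) (by norm_num) (by norm_num) (by norm_num) (c := 1) (by norm_num) ?_
  intro τ hτ
  simp only [g]
  field_simp
  ring

theorem approaches_lower_2_10 : Approaches 2 10 (2 / 3) := by
  refine approaches_atTop (by decide) (by decide) (fun τ => 2 * (3 * τ + 1) * (2 * τ + 1)) (fun τ => 3 * (5 * τ ^ 2 + 4 * τ + 1))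
    (by fun_prop) (by fun_prop) (by norm_num) (by norm_num) (by norm_num) (c := 1) (by norm_num) ?_
  intro τ hτ
  simp only [g]
  field_simp
  ring

theorem approaches_upper_2_10 : Approaches 2 10 ((1 + √2) / 3) := by
  have hr : √2 ^ 2 = (2 : ℝ) := Real.sq_sqrt (by norm_num)
  refine approaches_sqrt_two (by decide) (by decide) (fun τ => 2 * (τ + 3) * (τ + 2)) (fun τ => 3 * (τ ^ 2 + 4 * τ + 5))
    (by fun_prop) (by fun_prop) (by positivity) ?_ (by linear_combination (-√2 - 1) * hr) (c := 1) (by norm_num) ?_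
  · have := sqrt_two_sub_one_pos
    positivity
  intro τ hτ
  simp only [g]
  field_simp
  ring

theorem approaches_lower_3_4 : Approaches 3 4 (1 / 2) := by
  refine approaches_zero (by decide) (by decide) (fun τ => (τ + 1) * (τ + 1)) (fun τ => 2)
    (by fun_prop) (by fun_prop) (by norm_num) (by norm_num) (by norm_num) (c := -1) (by norm_num) ?_
  intro τ hτ
  simp only [g]
  field_simp
  ring

theorem approaches_inv_3_4 : Approaches 4 3 0 := by
  refine approaches_atTop (by decide) (by decide) (fun τ => -(2 * τ * τ)) (fun τ => (τ + 1) * (τ + 1))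
    (by fun_prop) (by fun_prop) (by norm_num) (by norm_num) (by norm_num) (c := 1) (by norm_num) ?_
  intro τ hτ
  simp only [g]
  field_simp

theorem approaches_lower_3_5 : Approaches 3 5 2 := by
  refine approaches_zero (by decide) (by decide) (fun τ => -(2 * (τ + 1) * (τ + 1))) (fun τ => (τ ^ 2 + 2 * τ - 1))
    (by fun_prop) (by fun_prop) (by norm_num) (by norm_num) (by norm_num) (c := -1) (by norm_num) ?_
  intro τ hτ
  simp only [g]
  field_simp
  ring

theorem approaches_inv_3_5 : Approaches 5 3 0 := by
  have hr : √2 ^ 2 = (2 : ℝ) := Real.sq_sqrt (by norm_num)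
  refine approaches_sqrt_two (by decide) (by decide) (fun τ => (τ ^ 2 + 2 * τ - 1)) (fun τ => 2 * (τ + 1) * (τ + 1))
    (by fun_prop) (by fun_prop) (by norm_num) ?_ (by linear_combination (1) * hr) (c := 1) (by norm_num) ?_
  · have := sqrt_two_sub_one_pos
    positivity
  intro τ hτ
  simp only [g]
  field_simp
  ring

theorem approaches_inv_3_7 : Approaches 7 3 0 := by
  refine approaches_zero (by decide) (by decide) (fun τ => 2 * (τ - 1) * τ * (τ + 2)) (fun τ => (2 * τ + 1) * (τ + 1) * (τ + 1) * (τ + 3))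
    (by fun_prop) (by fun_prop) (by norm_num) (by norm_num) (by norm_num) (c := 1) (by norm_num) ?_
  intro τ hτ
  simp only [g]
  field_simp
  ring

theorem approaches_lower_3_8 : Approaches 3 8 (1 / 2) := by
  refine approaches_atTop (by decide) (by decide) (fun τ => (τ + 1) * (τ + 1) * (3 * τ + 1)) (fun τ => 2 * (4 * τ ^ 2 + 3 * τ + 1))
    (by fun_prop) (by fun_prop) (by norm_num) (by norm_num) (by norm_num) (c := 1) (by norm_num) ?_
  intro τ hτ
  simp only [g]
  field_simp
  ring

theorem approaches_inv_3_8 : Approaches 8 3 0 := by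
  refine approaches_zero (by decide) (by decide) (fun τ => 2 * (τ ^ 2 + 3 * τ + 4) * τ) (fun τ => (τ + 1) * (τ + 1) * (τ + 3))
    (by fun_prop) (by fun_prop) (by norm_num) (by norm_num) (by norm_num) (c := 1) (by norm_num) ?_
  intro τ hτ
  simp only [g]
  field_simp
  ring

theorem approaches_lower_3_9 : Approaches 3 9 1 := by
  refine approaches_atTop (by decide) (by decide) (fun τ => (τ + 1) * (3 * τ + 1) * (τ + 2)) (fun τ => 2 * (2 * τ + 1) * (2 * τ + 1))
    (by fun_prop) (by fun_prop) (by norm_num) (by norm_num) (by norm_num) (c := 1) (by norm_num) ?_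
  intro τ hτ
  simp only [g]
  field_simp
  ring

theorem approaches_inv_3_9 : Approaches 9 3 0 := by
  refine approaches_zero (by decide) (by decide) (fun τ => 2 * (τ + 2) * (τ + 2) * τ) (fun τ => (τ + 1) * (2 * τ + 1) * (τ + 3))
    (by fun_prop) (by fun_prop) (by norm_num) (by norm_num) (by norm_num) (c := 1) (by norm_num) ?_
  intro τ hτ
  simp only [g]
  field_simp
  ring

theorem approaches_lower_3_10 : Approaches 3 10 1 := by
  refine approaches_atTop (by decide) (by decide) (fun τ => (τ + 1) * (τ + 1) * (3 * τ + 1)) (fun τ => (5 * τ ^ 2 + 4 * τ + 1))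
    (by fun_prop) (by fun_prop) (by norm_num) (by norm_num) (by norm_num) (c := 1) (by norm_num) ?_
  intro τ hτ
  simp only [g]
  field_simp
  ring

theorem approaches_inv_3_10 : Approaches 10 3 0 := by
  refine approaches_zero (by decide) (by decide) (fun τ => (τ ^ 2 + 4 * τ + 5) * τ) (fun τ => (τ + 1) * (τ + 1) * (τ + 3))
    (by fun_prop) (by fun_prop) (by norm_num) (by norm_num) (by norm_num) (c := 1) (by norm_num) ?_
  intro τ hτ
  simp only [g]
  field_simp
  ring

theorem approaches_lower_4_5 : Approaches 4 5 0 := by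
  refine approaches_atTop (by decide) (by decide) (fun τ => -(4 * τ * τ)) (fun τ => (-τ ^ 2 + 2 * τ + 1))
    (by fun_prop) (by fun_prop) (by norm_num) (by norm_num) (by norm_num) (c := 1) (by norm_num) ?_
  intro τ hτ
  simp only [g]
  field_simp
  ring

theorem approaches_inv_4_5 : Approaches 5 4 0 := by
  have hr : √2 ^ 2 = (2 : ℝ) := Real.sq_sqrt (by norm_num)
  refine approaches_sqrt_two (by decide) (by decide) (fun τ => (τ ^ 2 + 2 * τ - 1)) (fun τ => 4)
    (by fun_prop) (by fun_prop) (by norm_num) ?_ (by linear_combination (1) * hr) (c := -1) (by norm_num) ?_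
  · have := sqrt_two_sub_one_pos
    positivity
  intro τ hτ
  simp only [g]
  field_simp

theorem approaches_lower_4_7 : Approaches 4 7 0 := by
  refine approaches_atTop (by decide) (by decide) (fun τ => -((3 * τ + 1) * (τ + 2) * τ)) (fun τ => (2 * τ + 1) * (-τ + 1))
    (by fun_prop) (by fun_prop) (by norm_num) (by norm_num) (by norm_num) (c := 1) (by norm_num) ?_
  intro τ hτ
  simp only [g]
  field_simp
  ring

theorem approaches_inv_4_7 : Approaches 7 4 0 := by
  refine approaches_zero (by decide) (by decide) (fun τ => -((τ - 1) * τ * (τ + 2))) (fun τ => (2 * τ + 1) * (τ + 3))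
    (by fun_prop) (by fun_prop) (by norm_num) (by norm_num) (by norm_num) (c := 1) (by norm_num) ?_
  intro τ hτ
  simp only [g]
  field_simp
  ring

theorem approaches_lower_4_8 : Approaches 4 8 0 := by
  refine approaches_atTop (by decide) (by decide) (fun τ => -((3 * τ + 1) * τ * τ)) (fun τ => (4 * τ ^ 2 + 3 * τ + 1))
    (by fun_prop) (by fun_prop) (by norm_num) (by norm_num) (by norm_num) (c := 1) (by norm_num) ?_
  intro τ hτ
  simp only [g]
  field_simp
  ring

theorem approaches_inv_4_8 : Approaches 8 4 0 := by
  refine approaches_zero (by decide) (by decide) (fun τ => -((τ ^ 2 + 3 * τ + 4) * τ)) (fun τ => (τ + 3))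
    (by fun_prop) (by fun_prop) (by norm_num) (by norm_num) (by norm_num) (c := 1) (by norm_num) ?_
  intro τ hτ
  simp only [g]
  field_simp
  ring

theorem approaches_lower_4_9 : Approaches 4 9 0 := by
  refine approaches_atTop (by decide) (by decide) (fun τ => -((3 * τ + 1) * (τ + 2) * τ * τ)) (fun τ => (2 * τ + 1) * (2 * τ + 1) * (τ + 1))
    (by fun_prop) (by fun_prop) (by norm_num) (by norm_num) (by norm_num) (c := 1) (by norm_num) ?_
  intro τ hτ
  simp only [g]
  field_simp
  ring

theorem approaches_inv_4_9 : Approaches 9 4 0 := by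
  refine approaches_zero (by decide) (by decide) (fun τ => -((τ + 1) * (τ + 2) * (τ + 2) * τ)) (fun τ => (2 * τ + 1) * (τ + 3))
    (by fun_prop) (by fun_prop) (by norm_num) (by norm_num) (by norm_num) (c := 1) (by norm_num) ?_
  intro τ hτ
  simp only [g]
  field_simp
  ring

theorem approaches_lower_4_10 : Approaches 4 10 0 := by
  refine approaches_atTop (by decide) (by decide) (fun τ => -(2 * (3 * τ + 1) * τ * τ)) (fun τ => (5 * τ ^ 2 + 4 * τ + 1))
    (by fun_prop) (by fun_prop) (by norm_num) (by norm_num) (by norm_num) (c := 1) (by norm_num) ?_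
  intro τ hτ
  simp only [g]
  field_simp
  ring

theorem approaches_inv_4_10 : Approaches 10 4 0 := by
  refine approaches_zero (by decide) (by decide) (fun τ => -((τ ^ 2 + 4 * τ + 5) * τ)) (fun τ => 2 * (τ + 3))
    (by fun_prop) (by fun_prop) (by norm_num) (by norm_num) (by norm_num) (c := 1) (by norm_num) ?_
  intro τ hτ
  simp only [g]
  field_simp
  ring

theorem approaches_lower_5_7 : Approaches 5 7 0 := by
  have hr : √2 ^ 2 = (2 : ℝ) := Real.sq_sqrt (by norm_num)
  refine approaches_sqrt_two (by decide) (by decide) (fun τ => -((τ + 3) * (τ ^ 2 + 2 * τ - 1) * (2 * τ + 1))) (fun τ => 4 * τ * (τ + 2) * (τ - 1))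
    (by fun_prop) (by fun_prop) (by norm_num) ?_ (by linear_combination (-2 * √2 ^ 2 - 3 * √2 + 2) * hr) (c := -1) (by norm_num) ?_
  · have := sqrt_two_sub_one_pos
    have h2 : √2 - 1 - 1 ≠ 0 := by
      have : √2 < (2 : ℝ) := by rw [Real.sqrt_lt' (by norm_num)]; norm_num
      linarith
    positivity
  intro τ hτ
  simp only [g]
  field_simp
  ring

theorem approaches_inv_5_7 : Approaches 7 5 0 := by
  refine approaches_zero (by decide) (by decide) (fun τ => 4 * (τ - 1) * τ * (τ + 2)) (fun τ => (2 * τ + 1) * (τ + 3) * (τ ^ 2 + 2 * τ - 1))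
    (by fun_prop) (by fun_prop) (by norm_num) (by norm_num) (by norm_num) (c := 1) (by norm_num) ?_
  intro τ hτ
  simp only [g]
  field_simp
  ring

theorem approaches_lower_5_8 : Approaches 5 8 0 := by
  have hr : √2 ^ 2 = (2 : ℝ) := Real.sq_sqrt (by norm_num)
  refine approaches_sqrt_two (by decide) (by decide) (fun τ => (τ + 3) * (τ ^ 2 + 2 * τ - 1)) (fun τ => 4 * τ * (τ ^ 2 + 3 * τ + 4))
    (by fun_prop) (by fun_prop) (by norm_num) ?_ (by linear_combination (√2 + 2) * hr) (c := 1) (by norm_num) ?_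
  · have := sqrt_two_sub_one_pos
    positivity
  intro τ hτ
  simp only [g]
  field_simp
  ring

theorem approaches_inv_5_8 : Approaches 8 5 0 := by
  refine approaches_zero (by decide) (by decide) (fun τ => 4 * (τ ^ 2 + 3 * τ + 4) * τ) (fun τ => (τ + 3) * (τ ^ 2 + 2 * τ - 1))
    (by fun_prop) (by fun_prop) (by norm_num) (by norm_num) (by norm_num) (c := 1) (by norm_num) ?_
  intro τ hτ
  simp only [g]
  field_simp
  ring

theorem approaches_lower_5_9 : Approaches 5 9 0 := by
  have hr : √2 ^ 2 = (2 : ℝ) := Real.sq_sqrt (by norm_num)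
  refine approaches_sqrt_two (by decide) (by decide) (fun τ => (τ + 3) * (τ ^ 2 + 2 * τ - 1) * (2 * τ + 1)) (fun τ => 4 * τ * (τ + 2) * (τ + 2) * (τ + 1))
    (by fun_prop) (by fun_prop) (by norm_num) ?_ (by linear_combination (2 * √2 ^ 2 + 3 * √2 - 2) * hr) (c := 1) (by norm_num) ?_
  · have := sqrt_two_sub_one_pos
    positivity
  intro τ hτ
  simp only [g]
  field_simp
  ring

theorem approaches_inv_5_9 : Approaches 9 5 0 := by
  refine approaches_zero (by decide) (by decide) (fun τ => 4 * (τ + 1) * (τ + 2) * (τ + 2) * τ) (fun τ => (2 * τ + 1) * (τ + 3) * (τ ^ 2 + 2 * τ - 1))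
    (by fun_prop) (by fun_prop) (by norm_num) (by norm_num) (by norm_num) (c := 1) (by norm_num) ?_
  intro τ hτ
  simp only [g]
  field_simp
  ring

theorem approaches_lower_5_10 : Approaches 5 10 0 := by
  have hr : √2 ^ 2 = (2 : ℝ) := Real.sq_sqrt (by norm_num)
  refine approaches_sqrt_two (by decide) (by decide) (fun τ => (τ + 3) * (τ ^ 2 + 2 * τ - 1)) (fun τ => 2 * τ * (τ ^ 2 + 4 * τ + 5))
    (by fun_prop) (by fun_prop) (by norm_num) ?_ (by linear_combination (√2 + 2) * hr) (c := 1) (by norm_num) ?_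
  · have := sqrt_two_sub_one_pos
    positivity
  intro τ hτ
  simp only [g]
  field_simp
  ring

theorem approaches_inv_5_10 : Approaches 10 5 0 := by
  refine approaches_zero (by decide) (by decide) (fun τ => 2 * (τ ^ 2 + 4 * τ + 5) * τ) (fun τ => (τ + 3) * (τ ^ 2 + 2 * τ - 1))
    (by fun_prop) (by fun_prop) (by norm_num) (by norm_num) (by norm_num) (c := 1) (by norm_num) ?_
  intro τ hτ
  simp only [g]
  field_simp
  ring

theorem approaches_lower_7_8 : Approaches 7 8 0 := by
  refine approaches_atTop (by decide) (by decide) (fun τ => (-τ + 1) * (2 * τ + 1) * τ) (fun τ => (τ + 2) * (4 * τ ^ 2 + 3 * τ + 1))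
    (by fun_prop) (by fun_prop) (by norm_num) (by norm_num) (by norm_num) (c := 1) (by norm_num) ?_
  intro τ hτ
  simp only [g]
  field_simp
  ring

theorem approaches_upper_7_8 : Approaches 7 8 (1 / 2) := by
  refine approaches_zero (by decide) (by decide) (fun τ => -((τ - 1) * (τ + 2))) (fun τ => (2 * τ + 1) * (τ ^ 2 + 3 * τ + 4))
    (by fun_prop) (by fun_prop) (by norm_num) (by norm_num) (by norm_num) (c := -1) (by norm_num) ?_
  intro τ hτ
  simp only [g]
  field_simp
  ring

theorem approaches_lower_7_9 : Approaches 7 9 0 := by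
  refine approaches_atTop (by decide) (by decide) (fun τ => (-τ + 1) * τ) (fun τ => (τ + 1) * (2 * τ + 1))
    (by fun_prop) (by fun_prop) (by norm_num) (by norm_num) (by norm_num) (c := 1) (by norm_num) ?_
  intro τ hτ
  simp only [g]
  field_simp
  ring

theorem approaches_upper_7_9 : Approaches 7 9 (1 / 2) := by
  refine approaches_zero (by decide) (by decide) (fun τ => -((τ - 1))) (fun τ => (τ + 1) * (τ + 2))
    (by fun_prop) (by fun_prop) (by norm_num) (by norm_num) (by norm_num) (c := -1) (by norm_num) ?_
  intro τ hτ
  simp only [g]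
  field_simp

theorem approaches_lower_7_10 : Approaches 7 10 0 := by
  refine approaches_atTop (by decide) (by decide) (fun τ => 2 * (-τ + 1) * (2 * τ + 1) * τ) (fun τ => (τ + 2) * (5 * τ ^ 2 + 4 * τ + 1))
    (by fun_prop) (by fun_prop) (by norm_num) (by norm_num) (by norm_num) (c := 1) (by norm_num) ?_
  intro τ hτ
  simp only [g]
  field_simp
  ring

theorem approaches_upper_7_10 : Approaches 7 10 (4 / 5) := by
  refine approaches_zero (by decide) (by decide) (fun τ => -(2 * (τ - 1) * (τ + 2))) (fun τ => (2 * τ + 1) * (τ ^ 2 + 4 * τ + 5))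
    (by fun_prop) (by fun_prop) (by norm_num) (by norm_num) (by norm_num) (c := -1) (by norm_num) ?_
  intro τ hτ
  simp only [g]
  field_simp
  ring

theorem approaches_lower_8_9 : Approaches 8 9 1 := by
  refine approaches_zero (by decide) (by decide) (fun τ => (τ ^ 2 + 3 * τ + 4) * (2 * τ + 1)) (fun τ => (τ + 2) * (τ + 2) * (τ + 1))
    (by fun_prop) (by fun_prop) (by norm_num) (by norm_num) (by norm_num) (c := 1) (by norm_num) ?_
  intro τ hτ
  simp only [g]
  field_simp
  ring

theorem approaches_upper_8_9 : Approaches 8 9 2 := by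
  refine approaches_atTop (by decide) (by decide) (fun τ => (4 * τ ^ 2 + 3 * τ + 1) * (τ + 2)) (fun τ => (2 * τ + 1) * (2 * τ + 1) * (τ + 1))
    (by fun_prop) (by fun_prop) (by norm_num) (by norm_num) (by norm_num) (c := 1) (by norm_num) ?_
  intro τ hτ
  simp only [g]
  field_simp
  ring

theorem approaches_lower_8_10 : Approaches 8 10 (3 - √2) := by
  have hr : √2 ^ 2 = (2 : ℝ) := Real.sq_sqrt (by norm_num)
  have hb : √2 < (3 / 2 : ℝ) := by rw [Real.sqrt_lt' (by norm_num)]; norm_num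
  refine approaches_sqrt_two (by decide) (by decide) (fun τ => 2 * (τ ^ 2 + 3 * τ + 4)) (fun τ => (τ ^ 2 + 4 * τ + 5))
    (by fun_prop) (by fun_prop) (by linarith) ?_ (by linear_combination (√2 + 1) * hr) (c := 1) (by norm_num) ?_
  · have := sqrt_two_sub_one_pos
    positivity
  intro τ hτ
  simp only [g]
  field_simp

theorem approaches_upper_8_10 : Approaches 8 10 2 := by
  refine approaches_atTop (by decide) (by decide) (fun τ => 2 * (4 * τ ^ 2 + 3 * τ + 1)) (fun τ => (5 * τ ^ 2 + 4 * τ + 1))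
    (by fun_prop) (by fun_prop) (by norm_num) (by norm_num) (by norm_num) (c := 1) (by norm_num) ?_
  intro τ hτ
  simp only [g]
  field_simp
  ring

theorem approaches_lower_9_10 : Approaches 9 10 1 := by
  refine approaches_atTop (by decide) (by decide) (fun τ => 2 * (τ + 1) * (2 * τ + 1) * (2 * τ + 1)) (fun τ => (τ + 2) * (5 * τ ^ 2 + 4 * τ + 1))
    (by fun_prop) (by fun_prop) (by norm_num) (by norm_num) (by norm_num) (c := 1) (by norm_num) ?_
  intro τ hτ
  simp only [g]
  field_simp
  ring

theorem approaches_upper_9_10 : Approaches 9 10 (8 / 5) := by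
  refine approaches_zero (by decide) (by decide) (fun τ => 2 * (τ + 1) * (τ + 2) * (τ + 2)) (fun τ => (2 * τ + 1) * (τ ^ 2 + 4 * τ + 5))
    (by fun_prop) (by fun_prop) (by norm_num) (by norm_num) (by norm_num) (c := 1) (by norm_num) ?_
  intro τ hτ
  simp only [g]
  field_simp
  ring

/-! ### The bound `3/4` for the pair `(2,9)`, not reached by isosceles triangles. -/

open Filter Topology in
/-- The extremal triangles are flat ones with tangent lengths `1, 1 + d, d ^ 3`, `d → 0`. -/
theorem approaches_upper_2_9 : Approaches 2 9 (3 / 4) := by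
  intro ε hε
  -- `N` and `M` are the two numerators divided by `d²`. Near the flat isosceles limit the squared
  -- distances have one contribution of order `d²` from the asymmetry and one of order `z` from the
  -- small tangent length `z`; choosing `z = d³` makes the asymmetry dominate. The squared ratio
  -- tends to `81 / (9 * 16) = (3/4)²`.
  obtain ⟨N, hN⟩ : ∃ N : ℝ → ℝ, N = fun d =>
      4 * d ^ 16 + 12 * d ^ 14 + 24 * d ^ 13 - 3 * d ^ 12 + 24 * d ^ 11 - 2 * d ^ 10 - 84 * d ^ 9 -
      99 * d ^ 8 - 82 * d ^ 7 - 66 * d ^ 6 - 30 * d ^ 5 + 178 * d ^ 4 + 312 * d ^ 3 + 297 * d ^ 2 +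
      234 * d + 81 :=
    ⟨_, rfl⟩
  obtain ⟨M, hM⟩ : ∃ M : ℝ → ℝ, M = fun d =>
      d ^ 24 + 4 * d ^ 23 + 6 * d ^ 22 + 16 * d ^ 21 + 35 * d ^ 20 + 30 * d ^ 19 + 42 * d ^ 18 +
      54 * d ^ 17 - 23 * d ^ 16 - 80 * d ^ 15 - 105 * d ^ 14 - 194 * d ^ 13 - 226 * d ^ 12 - 62 * d ^ 11 +
      148 * d ^ 10 + 310 * d ^ 9 + 624 * d ^ 8 + 876 * d ^ 7 + 861 * d ^ 6 + 806 * d ^ 5 + 677 * d ^ 4 +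
      448 * d ^ 3 + 248 * d ^ 2 + 96 * d + 16 :=
    ⟨_, rfl⟩
  have cN : Continuous N := by rw [hN]; fun_prop
  have cM : Continuous M := by rw [hM]; fun_prop
  have N0 : N 0 = 81 := by rw [hN]; norm_num
  have M0 : M 0 = 16 := by rw [hM]; norm_num
  have cQ : Continuous fun d : ℝ => 1 + d + d ^ 3 * (2 + d) := by fun_prop
  have hlim : Tendsto (fun d => √(N d * (1 + d + d ^ 3 * (2 + d)) ^ 2 / (9 * M d))) (𝓝[>] 0)
      (𝓝 (3 / 4)) := by
    have h : Tendsto (fun d => √(N d * (1 + d + d ^ 3 * (2 + d)) ^ 2 / (9 * M d))) (𝓝 0)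
        (𝓝 √(N 0 * (1 + 0 + 0 ^ 3 * (2 + 0)) ^ 2 / (9 * M 0))) :=
      (((cN.mul (cQ.pow 2)).continuousAt.div (cM.const_mul 9).continuousAt
        (by rw [M0]; norm_num)).sqrt)
    have e : N 0 * (1 + 0 + 0 ^ 3 * (2 + 0)) ^ 2 / (9 * M 0) = (3 / 4) ^ 2 := by
      rw [N0, M0]; norm_num
    rw [e, Real.sqrt_sq (by norm_num)] at h
    exact h.mono_left nhdsWithin_le_nhds
  have pN : ∀ᶠ d in 𝓝[>] 0, 0 < N d :=
    (cN.continuousAt.eventually (lt_mem_nhds (by rw [N0]; norm_num))).filter_mono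
      nhdsWithin_le_nhds
  have pM : ∀ᶠ d in 𝓝[>] 0, 0 < M d :=
    (cM.continuousAt.eventually (lt_mem_nhds (by rw [M0]; norm_num))).filter_mono
      nhdsWithin_le_nhds
  obtain ⟨d, hd, hNd, hMd, hl⟩ := ((eventually_mem_nhdsWithin (a := (0 : ℝ)) (s := Set.Ioi 0)).and
    (pN.and (pM.and (Metric.tendsto_nhds.1 hlim ε hε)))).exists
  replace hd : 0 < d := hd
  have hy : 0 < 1 + d := by positivity
  have hz : 0 < d ^ 3 := by positivity
  obtain ⟨T, ha, hb, hc⟩ := exists_tri one_pos hy hz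
  have h2 := D_sq T one_pos hy hz ha hb hc (n := 2) (by decide)
  have h9 := D_sq T one_pos hy hz ha hb hc (n := 9) (by decide)
  simp only [num, den] at h2 h9
  have hS : 0 < 4 * ((1 + (1 + d) + d ^ 3) ^ 2 -
      (1 * (1 + d) + (1 + d) * d ^ 3 + d ^ 3 * 1)) ^ 2 := by
    have : (1 + (1 + d) + d ^ 3) ^ 2 - (1 * (1 + d) + (1 + d) * d ^ 3 + d ^ 3 * 1) =
      3 + 3 * d + d ^ 2 + 2 * d ^ 3 + d ^ 4 + d ^ 6 := by ring
    rw [this]; positivity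
  obtain ⟨S, hSe⟩ : ∃ S : ℝ, S = 4 * ((1 + (1 + d) + d ^ 3) ^ 2 -
      (1 * (1 + d) + (1 + d) * d ^ 3 + d ^ 3 * 1)) ^ 2 := ⟨_, rfl⟩
  rw [← hSe] at h2 h9 hS
  have hQ : 0 < 1 + d + d ^ 3 * (2 + d) := by positivity
  have h2' : S * D T 6 2 ^ 2 * 9 = d ^ 2 * N d := by
    rw [h2, hN]; ring
  have h9' : S * D T 6 9 ^ 2 * (1 + d + d ^ 3 * (2 + d)) ^ 2 = d ^ 2 * M d := by
    rw [hM]; linear_combination h9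
  have p2 : D T 6 2 ≠ 0 := by
    intro h; rw [h] at h2'; nlinarith [show 0 < d ^ 2 * N d by positivity]
  have p9 : D T 6 9 ≠ 0 := by
    intro h; rw [h] at h9'; nlinarith [show 0 < d ^ 2 * M d by positivity]
  refine ⟨T, p2, p9, ?_⟩
  have hratio : D T 6 2 / D T 6 9 = √(N d * (1 + d + d ^ 3 * (2 + d)) ^ 2 / (9 * M d)) := by
    have hnn : 0 ≤ D T 6 2 / D T 6 9 :=
      (div_pos (D_pos_of_ne p2) (D_pos_of_ne p9)).le
    rw [← Real.sqrt_sq hnn]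
    congr 1
    field_simp
    refine mul_left_cancel₀ (show S * d ^ 2 ≠ 0 by positivity) ?_
    linear_combination (S * D T 6 9 ^ 2 * (1 + d + d ^ 3 * (2 + d)) ^ 2) * h2' -
      (9 * S * D T 6 2 ^ 2) * h9'
  rw [hratio]
  exact hl

/-! ### The polynomial behind `C₆` and its critical point. -/

/-- The sign of `ratioF κ q t` decides whether `D(6,3)² ≥ κ D(6,7)²`, where `q = e₂ / e₁²` and
`t = e₃ / (e₁ e₂)` for the elementary symmetric functions of the tangent lengths. -/
def ratioF (κ q t : ℝ) : ℝ :=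
  q * (1 - t) ^ 2 * ((1 - q) ^ 2 - 12 * q * t) -
    4 * κ * t * (q ^ 2 - 4 * q ^ 3 + 6 * q ^ 2 * t + (36 * q - 27 * q ^ 2 - 12) * t ^ 2)

/-- The partial derivative of `ratioF κ q t` in `q`. -/
def ratioFq (κ q t : ℝ) : ℝ :=
  3 * q ^ 2 * t ^ 2 + 48 * q ^ 2 * t * κ - 6 * q ^ 2 * t + 3 * q ^ 2 + 216 * q * t ^ 3 * κ -
    24 * q * t ^ 3 - 48 * q * t ^ 2 * κ + 44 * q * t ^ 2 - 8 * q * t * κ - 16 * q * t - 4 * q -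
    144 * t ^ 3 * κ + t ^ 2 - 2 * t + 1

/-- The partial derivative of `ratioF κ q t` in `t`. -/
def ratioFt (κ q t : ℝ) : ℝ :=
  2 * q ^ 3 * t + 16 * q ^ 3 * κ - 2 * q ^ 3 + 324 * q ^ 2 * t ^ 2 * κ - 36 * q ^ 2 * t ^ 2 -
    48 * q ^ 2 * t * κ + 44 * q ^ 2 * t - 4 * q ^ 2 * κ - 8 * q ^ 2 - 432 * q * t ^ 2 * κ + 2 * q * t -
    2 * q + 144 * t ^ 2 * κ

/-- The minimal polynomial of `q` at the critical point of the ratio. -/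
def critPoly (q : ℝ) : ℝ :=
  3 * q ^ 10 - 87 * q ^ 9 - 3279 * q ^ 8 - 8719 * q ^ 7 + 243 * q ^ 6 + 28775 * q ^ 5 - 43085 * q ^ 4 +
    25595 * q ^ 3 - 6098 * q ^ 2 + 516 * q - 8

/-- The polynomial of which `C₆ ^ 2` is the largest root. -/
def polySq (y : ℝ) : ℝ :=
  6967296 * y ^ 10 + 2015974656 * y ^ 9 - 160813808784 * y ^ 8 + 603818269839 * y ^ 7 - 894980577861 * y ^ 6 +
    677249814873 * y ^ 5 - 274035844587 * y ^ 4 + 60418557684 * y ^ 3 - 6782842860 * y ^ 2 + 290960784 * y +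
    7744

theorem mul_mem_Icc {a b l₁ u₁ l₂ u₂ L U : ℝ} (ha : l₁ ≤ a ∧ a ≤ u₁) (hb : l₂ ≤ b ∧ b ≤ u₂)
    (h₁ : 0 ≤ l₁) (h₂ : 0 ≤ l₂) (hL : L ≤ l₁ * l₂) (hU : u₁ * u₂ ≤ U) :
    L ≤ a * b ∧ a * b ≤ U :=
  ⟨hL.trans (mul_le_mul ha.1 hb.1 h₂ (h₁.trans ha.1)),
    (mul_le_mul ha.2 hb.2 (h₂.trans hb.1) (h₁.trans (ha.1.trans ha.2))).trans hU⟩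

theorem ratioF_div {q N D K E : ℝ} (hD : D ≠ 0) (hE : E ≠ 0) :
    ratioF (K / E) q (N / D) * (D ^ 3 * E) =
      q ^ 3 * N ^ 2 * D * E + 16 * q ^ 3 * N * D ^ 2 * K - 2 * q ^ 3 * N * D ^ 2 * E + q ^ 3 * D ^ 3 * E +
      108 * q ^ 2 * N ^ 3 * K - 12 * q ^ 2 * N ^ 3 * E - 24 * q ^ 2 * N ^ 2 * D * K + 22 * q ^ 2 * N ^ 2 * D * E -
      4 * q ^ 2 * N * D ^ 2 * K - 8 * q ^ 2 * N * D ^ 2 * E - 2 * q ^ 2 * D ^ 3 * E - 144 * q * N ^ 3 * K +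
      q * N ^ 2 * D * E - 2 * q * N * D ^ 2 * E + q * D ^ 3 * E + 48 * N ^ 3 * K := by
  simp only [ratioF]
  field_simp
  ring

theorem ratioFq_div {q N D K E : ℝ} (hD : D ≠ 0) (hE : E ≠ 0) :
    ratioFq (K / E) q (N / D) * (D ^ 3 * E) =
      3 * q ^ 2 * N ^ 2 * D * E + 48 * q ^ 2 * N * D ^ 2 * K - 6 * q ^ 2 * N * D ^ 2 * E + 3 * q ^ 2 * D ^ 3 * E +
      216 * q * N ^ 3 * K - 24 * q * N ^ 3 * E - 48 * q * N ^ 2 * D * K + 44 * q * N ^ 2 * D * E -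
      8 * q * N * D ^ 2 * K - 16 * q * N * D ^ 2 * E - 4 * q * D ^ 3 * E - 144 * N ^ 3 * K + N ^ 2 * D * E -
      2 * N * D ^ 2 * E + D ^ 3 * E := by
  simp only [ratioFq]
  field_simp

theorem ratioFt_div {q N D K E : ℝ} (hD : D ≠ 0) (hE : E ≠ 0) :
    ratioFt (K / E) q (N / D) * (D ^ 2 * E) =
      2 * q ^ 3 * N * D * E + 16 * q ^ 3 * D ^ 2 * K - 2 * q ^ 3 * D ^ 2 * E + 324 * q ^ 2 * N ^ 2 * K -
      36 * q ^ 2 * N ^ 2 * E - 48 * q ^ 2 * N * D * K + 44 * q ^ 2 * N * D * E - 4 * q ^ 2 * D ^ 2 * K -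
      8 * q ^ 2 * D ^ 2 * E - 432 * q * N ^ 2 * K + 2 * q * N * D * E - 2 * q * D ^ 2 * E + 144 * N ^ 2 * K := by
  simp only [ratioFt]
  field_simp

theorem polySq_div {K E : ℝ} (hE : E ≠ 0) :
    polySq (K / E) * E ^ 10 =
      6967296 * K ^ 10 + 2015974656 * K ^ 9 * E - 160813808784 * K ^ 8 * E ^ 2 + 603818269839 * K ^ 7 * E ^ 3 -
      894980577861 * K ^ 6 * E ^ 4 + 677249814873 * K ^ 5 * E ^ 5 - 274035844587 * K ^ 4 * E ^ 6 +
      60418557684 * K ^ 3 * E ^ 7 - 6782842860 * K ^ 2 * E ^ 8 + 290960784 * K * E ^ 9 + 7744 * E ^ 10 := by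
  simp only [polySq]
  field_simp

/-- Eliminating `t` and `κ` from `ratioF = ratioFq = ratioFt = 0` gives `critPoly` for `q`, with `t
= N / D` and `κ = K / E` rational in `q`. A sign change isolates the root. After clearing
denominators each required equation is an explicit multiple of `critPoly q = 0`. -/
theorem exists_crit : ∃ q t κ : ℝ, (1285884121 / 5000000000 ≤ q ∧ q ≤ 2571768243 / 10000000000) ∧
    (302212609 / 5000000000 ≤ t ∧ t ≤ 604425219 / 10000000000) ∧ (30914259 / 500000 ≤ κ ∧ κ ≤ 61828519 / 1000000) ∧
    ratioF κ q t = 0 ∧ ratioFq κ q t = 0 ∧ ratioFt κ q t = 0 ∧ polySq κ = 0 := by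
  have hc : Continuous critPoly := by unfold critPoly; fun_prop
  -- The interval is narrow enough that the enclosures of the powers of `q` below yield the stated
  -- digits of `t` and `κ` by linear arithmetic.
  obtain ⟨q, hq, hm⟩ : ∃ q : ℝ, (25717682425326951929 / 100000000000000000000 ≤ q ∧ q ≤ 2571768242532695193 / 10000000000000000000) ∧
      critPoly q = 0 := by
    obtain ⟨q, hq, h⟩ := intermediate_value_Icc (show (25717682425326951929 / 100000000000000000000 : ℝ) ≤
      2571768242532695193 / 10000000000000000000 by norm_num) hc.continuousOn
      (show (0 : ℝ) ∈ Set.Icc _ _ from ⟨by norm_num [critPoly], by norm_num [critPoly]⟩)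
    exact ⟨q, hq, h⟩
  have h2 : 66139918932997077238163 / 1000000000000000000000000 ≤ q ^ 2 ∧ q ^ 2 ≤ 66139918932997077243307 / 1000000000000000000000000 :=
    pow_succ q 1 ▸ mul_mem_Icc (pow_one q ▸ hq) hq (by norm_num) (by norm_num) (by norm_num) (by norm_num)
  have h3 : 17009654307556882599433 / 1000000000000000000000000 ≤ q ^ 3 ∧ q ^ 3 ≤ 8504827153778441300709 / 500000000000000000000000 :=
    pow_succ q 2 ▸ mul_mem_Icc h2 hq (by norm_num) (by norm_num) (by norm_num) (by norm_num)
  have h4 : 4374488876463425236027 / 1000000000000000000000000 ≤ q ^ 4 ∧ q ^ 4 ≤ 1093622219115856309177 / 250000000000000000000000 :=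
    pow_succ q 3 ▸ mul_mem_Icc h3 hq (by norm_num) (by norm_num) (by norm_num) (by norm_num)
  have h5 : 281254289245029187311 / 250000000000000000000000 ≤ q ^ 5 ∧ q ^ 5 ≤ 140627144622514593683 / 125000000000000000000000 :=
    pow_succ q 4 ▸ mul_mem_Icc h4 hq (by norm_num) (by norm_num) (by norm_num) (by norm_num)
  unfold critPoly at hm
  obtain ⟨N, hN⟩ : ∃ N, N = 6 * q ^ 5 + 11 * q ^ 4 + 1007 * q ^ 3 - 1695 * q ^ 2 + 691 * q - 68 := ⟨_, rfl⟩
  obtain ⟨D, hD⟩ : ∃ D, D = -165 * q ^ 4 - 3339 * q ^ 3 + 147 * q ^ 2 + 1347 * q - 54 := ⟨_, rfl⟩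
  obtain ⟨K, hK⟩ : ∃ K, K = 3587 * q ^ 5 + 54813 * q ^ 4 + 24462 * q ^ 3 - 38923 * q ^ 2 + 20413 * q - 388 := ⟨_, rfl⟩
  obtain ⟨E, hE⟩ : ∃ E, E = 15501 * q ^ 5 + 136692 * q ^ 4 - 132795 * q ^ 3 + 68434 * q ^ 2 - 15348 * q + 1112 := ⟨_, rfl⟩
  have D0 : 0 < D := by linarith
  have E0 : 0 < E := by linarith
  have Dne : D ≠ 0 := D0.ne'
  have Ene : E ≠ 0 := E0.ne'
  refine ⟨q, N / D, K / E, ⟨by linarith, by linarith⟩, ⟨?_, ?_⟩, ⟨?_, ?_⟩, ?_, ?_, ?_, ?_⟩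
  · rw [le_div_iff₀ D0]; linarith
  · rw [div_le_iff₀ D0]; linarith
  · rw [le_div_iff₀ E0]; linarith
  · rw [div_le_iff₀ E0]; linarith
  · refine (mul_eq_zero.1 ?_).resolve_right (mul_ne_zero (pow_ne_zero 3 Dne) Ene)
    rw [ratioF_div Dne Ene, hN, hD, hK, hE]
    linear_combination
      (-16192332 * q ^ 12 - 191010888 * q ^ 11 + 14054881896 * q ^ 10 + 104875496088 * q ^ 9 - 390832041036 * q ^ 8 +
      958092259704 * q ^ 7 - 1824882027516 * q ^ 6 + 2132937569328 * q ^ 5 - 1473348920904 * q ^ 4 +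
      595557660480 * q ^ 3 - 134995480716 * q ^ 2 + 15809780424 * q - 731997696) * hm
  · refine (mul_eq_zero.1 ?_).resolve_right (mul_ne_zero (pow_ne_zero 3 Dne) Ene)
    rw [ratioFq_div Dne Ene, hN, hD, hK, hE]
    linear_combination
      (-63076644 * q ^ 11 - 802245168 * q ^ 10 + 34741433664 * q ^ 9 + 307146632688 * q ^ 8 - 1605788005548 * q ^ 7 +
      3034576359096 * q ^ 6 - 3175299457524 * q ^ 5 + 2274051593064 * q ^ 4 - 1119711491520 * q ^ 3 +
      319074908760 * q ^ 2 - 43347299004 * q + 2197464264) * hm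
  · refine (mul_eq_zero.1 ?_).resolve_right (mul_ne_zero (pow_ne_zero 2 Dne) Ene)
    rw [ratioFt_div Dne Ene, hN, hD, hK, hE]
    linear_combination
      (-2980836 * q ^ 7 - 169166040 * q ^ 6 - 250680108 * q ^ 5 + 1841365428 * q ^ 4 - 2407616472 * q ^ 3 +
      1399073316 * q ^ 2 - 369471384 * q + 32294016) * hm
  · refine (mul_eq_zero.1 ?_).resolve_right (pow_ne_zero 10 Ene)
    rw [polySq_div Ene, hK, hE]
    linear_combination
      (-236463001264239202757553320163904781079005822664 * q ^ 40 - 17665369484476327322717134448470296614256013494108 * q ^ 39 -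
      597612517412815536538438297190206032609293281410318 * q ^ 38 - 11947091564503594746643661225266842464315105931677217 * q ^ 37 -
      152120550863942263391639304131271331607301468193383624 * q ^ 36 - 1220308725182806109145267836372316318734093348163203982 * q ^ 35 -
      5522432584903903739139410917419129081335866314132011970 * q ^ 34 - 8210929293069566522497010885514739382053928125737164847 * q ^ 33 +
      30394456978590000333421629232878552386029300920244059732 * q ^ 32 + 74769867980798779730471765430125150864260378119344783790 * q ^ 31 -
      229072597172650324529823592670859710360561903139942557742 * q ^ 30 - 155824408737352716406578172966361543711808874449774221583 * q ^ 29 +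
      1277680263704469203115624431434555596511348002530015819040 * q ^ 28 - 1742614594926550520970860276402391157951280483008859778960 * q ^ 27 -
      435950190489055516551917463631391274568194200024907263820 * q ^ 26 + 4946195755367056225290768124824672021330008274360299258886 * q ^ 25 -
      8284494477746827697776052741946951422702312662170899679456 * q ^ 24 + 6796118689572136465555855442805248446157315636105320292856 * q ^ 23 -
      384348752865961371568521484936009145353473408122762640594 * q ^ 22 - 7326733978412283708472571447925468816313526991976216261539 * q ^ 21 +
      12233026868745296555858633716231885792533065026542062519064 * q ^ 20 - 12746270827573781693610825347943720300942901928368266673638 * q ^ 19 +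
      10055479823884510887205920255666062653056655090107041509710 * q ^ 18 - 6388307213912136142246077685511864539716944227726702400079 * q ^ 17 +
      3358274406244300677506142932148130574751734541051255351156 * q ^ 16 - 1479715420457175998101957904586246531732554084485065384426 * q ^ 15 +
      549269331766353943877042117628004341940133953877936826846 * q ^ 14 - 171743241238626889282726207431141287311169280912519722821 * q ^ 13 +
      45037017589700366238089826562819426879561050211037062128 * q ^ 12 - 9823386605328812915869669363240541382663448879790726812 * q ^ 11 +
      1760489547589370684456646945060609944301580885093163504 * q ^ 10 - 255019880863733258259473992054576628137685840450014192 * q ^ 9 +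
      29257134041530670729793381633734193934801450523221376 * q ^ 8 - 2596820453902414047812939685599080707269929481886272 * q ^ 7 +
      174016664645320514370019916539883511440965737155840 * q ^ 6 - 8592564864512657370186470042558498130116344583168 * q ^ 5 +
      304452453724521210047379399087535685303365341184 * q ^ 4 - 7472357648888941296403171645908812593011015680 * q ^ 3 +
      120019579243953667855980491170883390883168256 * q ^ 2 - 1130993533002421932747404528665812617920512 * q +
      4729979479292874037432682621947947778048) * hm

/-! ### Nonnegativity of `ratioF` away from the critical point. -/

/-- Away from the critical value of `t` there is slack, so the round value `62`, slightly above the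
optimal `κ`, may be used. With `q + u = 1/3` and `t + v = 1/60`, homogenizing in `(q, u)` and in
`(t, v)` leaves positive coefficients, as in a Bernstein expansion on a rectangle; the part without
a factor `q` is `2976 t³`. -/
theorem ratioF_nonneg_of_le {q t : ℝ} (hq : 0 ≤ q) (hq' : q ≤ 1 / 3) (ht : 0 ≤ t)
    (ht' : t ≤ 1 / 60) : 0 ≤ ratioF 62 q t := by
  obtain ⟨u, hu⟩ : ∃ u, u = 1 / 3 - q := ⟨_, rfl⟩
  obtain ⟨v, hv⟩ : ∃ v, v = 1 / 60 - t := ⟨_, rfl⟩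
  have hu0 : 0 ≤ u := by linarith
  have hv0 : 0 ≤ v := by linarith
  have h : 0 ≤ 2976 * t ^ 3 + q *
      (3824460 * q ^ 3 * t ^ 3 + 11392560 * q ^ 3 * t ^ 2 * v + 9979200 * q ^ 3 * t * v ^ 2 + 2592000 * q ^ 3 * v ^ 3 +
      1706904 * q ^ 2 * u * t ^ 3 + 16565760 * q ^ 2 * u * t ^ 2 * v + 24624000 * q ^ 2 * u * t * v ^ 2 +
      10368000 * q ^ 2 * u * v ^ 3 + 3280608 * q * u ^ 2 * t ^ 3 + 22282020 * q * u ^ 2 * t ^ 2 * v +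
      31946400 * q * u ^ 2 * t * v ^ 2 + 13608000 * q * u ^ 2 * v ^ 3 + 5398164 * u ^ 3 * t ^ 3 +
      17108820 * u ^ 3 * t ^ 2 * v + 17301600 * u ^ 3 * t * v ^ 2 + 5832000 * u ^ 3 * v ^ 3) := by
    positivity
  refine h.trans_eq ?_
  subst hu hv
  simp only [ratioF]
  ring

/-- The region is a triangle in the `(q, t)` plane, and `x, y, z` are multiples of its barycentric
coordinates, with constant sum `19/300`. Homogenized to degree 5, `ratioF` has nonnegative
coefficients; the `z⁵` term is missing because `ratioF` vanishes at the equilateral vertex `q =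
1/3`, `t = 1/9`. -/
theorem ratioF_nonneg_of_ge {q t : ℝ} (hq : 3 * t ≤ q) (hq' : q ≤ 1 / 3)
    (ht : 9 / 100 ≤ t) : 0 ≤ ratioF 62 q t := by
  obtain ⟨x, hx⟩ : ∃ x, x = 1 / 3 - q := ⟨_, rfl⟩
  obtain ⟨y, hy⟩ : ∃ y, y = q - 3 * t := ⟨_, rfl⟩
  obtain ⟨z, hz⟩ : ∃ z, z = 3 * (t - 9 / 100) := ⟨_, rfl⟩
  have hx0 : 0 ≤ x := by linarith
  have hy0 : 0 ≤ y := by linarith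
  have hz0 : 0 ≤ z := by linarith
  have h : 0 ≤ 9404268399 / 130321 * x ^ 5 + 20482250166 / 130321 * x ^ 4 * y + 38517597900 / 130321 * x ^ 4 * z +
      8891407935 / 130321 * x ^ 3 * y ^ 2 + 56537177400 / 130321 * x ^ 3 * y * z + 57771720000 / 130321 * x ^ 3 * z ^ 2 +
      751018968 / 130321 * x ^ 2 * y ^ 3 + 15118932300 / 130321 * x ^ 2 * y ^ 2 * z + 50325160000 / 130321 * x ^ 2 * y * z ^ 2 +
      37224000000 / 130321 * x ^ 2 * z ^ 3 + 9735472800 / 130321 * x * y ^ 4 + 21231112800 / 130321 * x * y ^ 3 * z +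
      58982920000 / 390963 * x * y ^ 2 * z ^ 2 + 50096000000 / 390963 * x * y * z ^ 3 + 25600000000 / 390963 * x * z ^ 4 +
      6797880000 / 130321 * y ^ 5 + 24131760000 / 130321 * y ^ 4 * z + 276428920000 / 1172889 * y ^ 3 * z ^ 2 +
      146024000000 / 1172889 * y ^ 2 * z ^ 3 + 25600000000 / 1172889 * y * z ^ 4 := by
    positivity
  refine h.trans_eq ?_
  subst hx hy hz
  simp only [ratioF]
  ring

/-! ### Nonnegativity of `ratioF` around the critical point. -/

theorem abs_pow_mul_pow_le {x y : ℝ} (hx : |x| ≤ 1) (hy : |y| ≤ 1) {m n : ℕ} (h : 2 ≤ m + n) :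
    |x ^ m * y ^ n| ≤ x ^ 2 + y ^ 2 := by
  rw [abs_mul, abs_pow, abs_pow, ← sq_abs x, ← sq_abs y]
  have hx0 := abs_nonneg x
  have hy0 := abs_nonneg y
  rcases le_total |x| |y| with hxy | hxy
  · calc |x| ^ m * |y| ^ n ≤ |y| ^ m * |y| ^ n := by gcongr
      _ = |y| ^ (m + n) := (pow_add _ _ _).symm
      _ ≤ |y| ^ 2 := pow_le_pow_of_le_one hy0 hy h
      _ ≤ _ := le_add_of_nonneg_left (sq_nonneg _)
  · calc |x| ^ m * |y| ^ n ≤ |x| ^ m * |x| ^ n := by gcongr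
      _ = |x| ^ (m + n) := (pow_add _ _ _).symm
      _ ≤ |x| ^ 2 := pow_le_pow_of_le_one hx0 hx h
      _ ≤ _ := le_add_of_nonneg_right (sq_nonneg _)

theorem sub_le_mul_of_abs_sub_le {a c ε m s : ℝ} (ha : c - ε ≤ a ∧ a ≤ c + ε) (hε : 0 ≤ ε)
    (hm : |m| ≤ s) : c * m - ε * s ≤ a * m := by
  have h1 : |a - c| ≤ ε := abs_le.2 ⟨by linarith, by linarith⟩
  have h2 : |(a - c) * m| ≤ ε * s := by
    rw [abs_mul]
    exact mul_le_mul h1 hm (abs_nonneg _) hε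
  linarith [(abs_le.1 h2).1]

/-- The rounded Taylor polynomial of `ratioF` at its critical point. -/
theorem taylor_model_nonneg {x y : ℝ} (hy : -219 / 5000 ≤ y) (hy' : y ≤ 37 / 1250)
    (hx : 3 * y - 1517 / 20000 ≤ x) :
    3 / 250 * (x ^ 2 + y ^ 2) ≤
      x ^ 3 * y ^ 2 + 987377 / 1000 * x ^ 3 * y + 15169 / 250 * x ^ 3 + 166637 / 25 * x ^ 2 * y ^ 3 -
      126239 / 500 * x ^ 2 * y ^ 2 + 402811 / 1000 * x ^ 2 * y + 25513 / 1000 * x ^ 2 - 5474893 / 1000 * x * y ^ 3 -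
      435869 / 250 * x * y ^ 2 - 1102331727 / 12500000 * x * y + 1118899 / 1000 * y ^ 3 + 106473 / 1000 * y ^ 2 := by
  obtain ⟨u, hu⟩ : ∃ u, u = y + 219 / 5000 := ⟨_, rfl⟩
  obtain ⟨v, hv⟩ : ∃ v, v = 37 / 1250 - y := ⟨_, rfl⟩
  obtain ⟨z, hz⟩ : ∃ z, z = x - (3 * y - 1517 / 20000) := ⟨_, rfl⟩
  have hu0 : 0 ≤ u := by linarith
  have hv0 : 0 ≤ v := by linarith
  have hz0 : 0 ≤ z := by linarith
  -- After subtracting `3/250 (x² + y²)`, the quadratic part is `25.501 (x - 1.72908 y)²` plus a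
  -- positive multiple of `y²`; the unusual `x y` coefficient of the model makes this completion of
  -- the square exact. The certificate keeps these two squares, with multipliers nonnegative on the
  -- strip given by `u, v, z ≥ 0`, where `u + v` is constant.
  have h : 0 ≤ (x - 43227 / 25000 * y) ^ 2 *
      ((2247580884 / 134689 * u ^ 2 + 2683216341 / 134689 * u * v + 435770146 / 134689 * v ^ 2) * z +
      (18649507591473591 / 154471446875 * u ^ 3 + 97654281933068319 / 617885787500 * u ^ 2 * v + 7013708726673502 / 154471446875 * u * v ^ 2 +
      219021893844288 / 154471446875 * v ^ 3)) +
      y ^ 2 * ((1125623571747862727 / 21045156250000 * u ^ 2 + 4563094084199860167 / 84180625000000 * u * v +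
      1000871588245986851 / 42090312500000 * v ^ 2) * z +
      (990121236984893997714861 / 96544654296875000000 * u ^ 3 + 41280215906377487062209749 / 386178617187500000000 * u ^ 2 * v +
      18582117937256365683012067 / 96544654296875000000 * u * v ^ 2 + 2249184724551268092314449 / 48272327148437500000 * v ^ 3)) := by
    positivity
  rw [← sub_nonneg]
  refine h.trans_eq ?_
  subst hu hv hz
  ring

-- The Taylor expansion at `(q, t)` is exact and starts at order two, because the value and both
-- partial derivatives vanish. Each of its twelve remaining coefficients is within `1/1000` of a
-- rational constant, and each monomial is at most `x² + y²` in absolute value. The total error is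
-- thus at most `12/1000 = 3/250` times `x² + y²`, which is the margin in `taylor_model_nonneg`.
set_option maxHeartbeats 2000000 in
theorem ratioF_nonneg_near {q t κ : ℝ}
    (hq : 1285884121 / 5000000000 ≤ q ∧ q ≤ 2571768243 / 10000000000)
    (ht : 302212609 / 5000000000 ≤ t ∧ t ≤ 604425219 / 10000000000)
    (hκ : 30914259 / 500000 ≤ κ ∧ κ ≤ 61828519 / 1000000)
    (h0 : ratioF κ q t = 0) (hFq : ratioFq κ q t = 0) (hFt : ratioFt κ q t = 0) {q' t' : ℝ}
    (h3 : 3 * t' ≤ q') (hq' : q' ≤ 1 / 3) (htl : 1 / 60 ≤ t') (htu : t' ≤ 9 / 100) :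
    0 ≤ ratioF κ q' t' := by
  obtain ⟨x, hx⟩ : ∃ x, x = q' - q := ⟨_, rfl⟩
  obtain ⟨y, hy⟩ : ∃ y, y = t' - t := ⟨_, rfl⟩
  have hx1 : |x| ≤ 1 := abs_le.2 ⟨by linarith, by linarith⟩
  have hy1 : |y| ≤ 1 := abs_le.2 ⟨by linarith, by linarith⟩
  -- In `habc` the three digits are the exponents of `q, t, κ`; these enclosures make every Taylor
  -- coefficient accessible to linear arithmetic.
  have h011 : 934267886769 / 250000000000 ≤ t * κ ∧ t * κ ≤ 3737071613703 / 1000000000000 := by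
    have h := mul_mem_Icc ht hκ (L := 934267886769 / 250000000000) (U := 3737071613703 / 1000000000000) (by norm_num)
      (by norm_num) (by norm_num) (by norm_num)
    ring_nf at h ⊢
    exact h
  have h020 : 3653298441 / 1000000000000 ≤ t ^ 2 ∧ t ^ 2 ≤ 1826649227 / 500000000000 := by
    have h := mul_mem_Icc ht ht (L := 3653298441 / 1000000000000) (U := 1826649227 / 500000000000) (by norm_num)
      (by norm_num) (by norm_num) (by norm_num)
    ring_nf at h ⊢
    exact h
  have h101 : 1987607738029 / 125000000000 ≤ q * κ ∧ q * κ ≤ 15900862167593 / 1000000000000 := by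
    have h := mul_mem_Icc hq hκ (L := 1987607738029 / 125000000000) (U := 15900862167593 / 1000000000000) (by norm_num)
      (by norm_num) (by norm_num) (by norm_num)
    ring_nf at h ⊢
    exact h
  have h110 : 15544415803 / 1000000000000 ≤ q * t ∧ q * t ≤ 3108883167 / 200000000000 := by
    have h := mul_mem_Icc hq ht (L := 15544415803 / 1000000000000) (U := 3108883167 / 200000000000) (by norm_num)
      (by norm_num) (by norm_num) (by norm_num)
    ring_nf at h ⊢
    exact h
  have h200 : 13227983781 / 200000000000 ≤ q ^ 2 ∧ q ^ 2 ≤ 33069959479 / 500000000000 := by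
    have h := mul_mem_Icc hq hq (L := 13227983781 / 200000000000) (U := 33069959479 / 500000000000) (by norm_num)
      (by norm_num) (by norm_num) (by norm_num)
    ring_nf at h ⊢
    exact h
  have h021 : 112939014209 / 500000000000 ≤ t ^ 2 * κ ∧ t ^ 2 * κ ≤ 56469508219 / 250000000000 := by
    have h := mul_mem_Icc h020 hκ (L := 112939014209 / 500000000000) (U := 56469508219 / 250000000000) (by norm_num)
      (by norm_num) (by norm_num) (by norm_num)
    ring_nf at h ⊢
    exact h
  have h030 : 22081457 / 100000000000 ≤ t ^ 3 ∧ t ^ 3 ≤ 55203643 / 250000000000 := by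
    have h := mul_mem_Icc h020 ht (L := 22081457 / 100000000000) (U := 55203643 / 250000000000) (by norm_num)
      (by norm_num) (by norm_num) (by norm_num)
    ring_nf at h ⊢
    exact h
  have h111 : 38443527691 / 40000000000 ≤ q * t * κ ∧ q * t * κ ≤ 961088209799 / 1000000000000 := by
    have h := mul_mem_Icc h110 hκ (L := 38443527691 / 40000000000) (U := 961088209799 / 1000000000000) (by norm_num)
      (by norm_num) (by norm_num) (by norm_num)
    ring_nf at h ⊢
    exact h
  have h120 : 939543691 / 1000000000000 ≤ q * t ^ 2 ∧ q * t ^ 2 ≤ 187908739 / 200000000000 := by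
    have h := mul_mem_Icc h110 ht (L := 939543691 / 1000000000000) (U := 187908739 / 200000000000) (by norm_num)
      (by norm_num) (by norm_num) (by norm_num)
    ring_nf at h ⊢
    exact h
  have h201 : 511166645817 / 125000000000 ≤ q ^ 2 * κ ∧ q ^ 2 * κ ≤ 2044666617977 / 500000000000 := by
    have h := mul_mem_Icc h200 hκ (L := 511166645817 / 125000000000) (U := 2044666617977 / 500000000000) (by norm_num)
      (by norm_num) (by norm_num) (by norm_num)
    ring_nf at h ⊢
    exact h
  have h210 : 399766349 / 100000000000 ≤ q ^ 2 * t ∧ q ^ 2 * t ≤ 3997663501 / 1000000000000 := by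
    have h := mul_mem_Icc h200 ht (L := 399766349 / 100000000000) (U := 3997663501 / 1000000000000) (by norm_num)
      (by norm_num) (by norm_num) (by norm_num)
    ring_nf at h ⊢
    exact h
  have h300 : 2126206787 / 125000000000 ≤ q ^ 3 ∧ q ^ 3 ≤ 8504827159 / 500000000000 := by
    have h := mul_mem_Icc h200 hq (L := 2126206787 / 125000000000) (U := 8504827159 / 500000000000) (by norm_num)
      (by norm_num) (by norm_num) (by norm_num)
    ring_nf at h ⊢
    exact h
  have h031 : 2730527523 / 200000000000 ≤ t ^ 3 * κ ∧ t ^ 3 * κ ≤ 13652637961 / 1000000000000 := by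
    have h := mul_mem_Icc h030 hκ (L := 2730527523 / 200000000000) (U := 13652637961 / 1000000000000) (by norm_num)
      (by norm_num) (by norm_num) (by norm_num)
    ring_nf at h ⊢
    exact h
  have h121 : 5809059401 / 100000000000 ≤ q * t ^ 2 * κ ∧ q * t ^ 2 * κ ≤ 29045297599 / 500000000000 := by
    have h := mul_mem_Icc h120 hκ (L := 5809059401 / 100000000000) (U := 29045297599 / 500000000000) (by norm_num)
      (by norm_num) (by norm_num) (by norm_num)
    ring_nf at h ⊢
    exact h
  have h211 : 247169609049 / 1000000000000 ≤ q ^ 2 * t * κ ∧ q ^ 2 * t * κ ≤ 7724050429 / 31250000000 := by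
    have h := mul_mem_Icc h210 hκ (L := 247169609049 / 1000000000000) (U := 7724050429 / 31250000000) (by norm_num)
      (by norm_num) (by norm_num) (by norm_num)
    ring_nf at h ⊢
    exact h
  have a02 := sub_le_mul_of_abs_sub_le (a := q ^ 3 + 324 * q ^ 2 * t * κ - 36 * q ^ 2 * t - 24 * q ^ 2 * κ + 22 * q ^ 2 - 432 * q * t * κ +
      q + 144 * t * κ)
    (c := 106473 / 1000) (ε := 1 / 1000) (by constructor <;> linarith) (by norm_num)
    (abs_pow_mul_pow_le (m := 0) (n := 2) hx1 hy1 (by norm_num))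
  have a03 := sub_le_mul_of_abs_sub_le (a := 108 * q ^ 2 * κ - 12 * q ^ 2 - 144 * q * κ + 48 * κ)
    (c := 1118899 / 1000) (ε := 1 / 1000) (by constructor <;> linarith) (by norm_num)
    (abs_pow_mul_pow_le (m := 0) (n := 3) hx1 hy1 (by norm_num))
  have a11 := sub_le_mul_of_abs_sub_le (a := 6 * q ^ 2 * t + 48 * q ^ 2 * κ - 6 * q ^ 2 + 648 * q * t ^ 2 * κ - 72 * q * t ^ 2 - 96 * q * t * κ +
      88 * q * t - 8 * q * κ - 16 * q - 432 * t ^ 2 * κ + 2 * t - 2)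
    (c := -1102331727 / 12500000) (ε := 1 / 1000) (by constructor <;> linarith) (by norm_num)
    (abs_pow_mul_pow_le (m := 1) (n := 1) hx1 hy1 (by norm_num))
  have a12 := sub_le_mul_of_abs_sub_le (a := 3 * q ^ 2 + 648 * q * t * κ - 72 * q * t - 48 * q * κ + 44 * q - 432 * t * κ + 1)
    (c := -435869 / 250) (ε := 1 / 1000) (by constructor <;> linarith) (by norm_num)
    (abs_pow_mul_pow_le (m := 1) (n := 2) hx1 hy1 (by norm_num))
  have a13 := sub_le_mul_of_abs_sub_le (a := 216 * q * κ - 24 * q - 144 * κ)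
    (c := -5474893 / 1000) (ε := 1 / 1000) (by constructor <;> linarith) (by norm_num)
    (abs_pow_mul_pow_le (m := 1) (n := 3) hx1 hy1 (by norm_num))
  have a20 := sub_le_mul_of_abs_sub_le (a := 3 * q * t ^ 2 + 48 * q * t * κ - 6 * q * t + 3 * q + 108 * t ^ 3 * κ - 12 * t ^ 3 - 24 * t ^ 2 * κ +
      22 * t ^ 2 - 4 * t * κ - 8 * t - 2)
    (c := 25513 / 1000) (ε := 1 / 1000) (by constructor <;> linarith) (by norm_num)
    (abs_pow_mul_pow_le (m := 2) (n := 0) hx1 hy1 (by norm_num))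
  have a21 := sub_le_mul_of_abs_sub_le (a := 6 * q * t + 48 * q * κ - 6 * q + 324 * t ^ 2 * κ - 36 * t ^ 2 - 48 * t * κ + 44 * t - 4 * κ -
      8)
    (c := 402811 / 1000) (ε := 1 / 1000) (by constructor <;> linarith) (by norm_num)
    (abs_pow_mul_pow_le (m := 2) (n := 1) hx1 hy1 (by norm_num))
  have a22 := sub_le_mul_of_abs_sub_le (a := 3 * q + 324 * t * κ - 36 * t - 24 * κ + 22)
    (c := -126239 / 500) (ε := 1 / 1000) (by constructor <;> linarith) (by norm_num)
    (abs_pow_mul_pow_le (m := 2) (n := 2) hx1 hy1 (by norm_num))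
  have a23 := sub_le_mul_of_abs_sub_le (a := 108 * κ - 12)
    (c := 166637 / 25) (ε := 1 / 1000) (by constructor <;> linarith) (by norm_num)
    (abs_pow_mul_pow_le (m := 2) (n := 3) hx1 hy1 (by norm_num))
  have a30 := sub_le_mul_of_abs_sub_le (a := t ^ 2 + 16 * t * κ - 2 * t + 1)
    (c := 15169 / 250) (ε := 1 / 1000) (by constructor <;> linarith) (by norm_num)
    (abs_pow_mul_pow_le (m := 3) (n := 0) hx1 hy1 (by norm_num))
  have a31 := sub_le_mul_of_abs_sub_le (a := 2 * t + 16 * κ - 2)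
    (c := 987377 / 1000) (ε := 1 / 1000) (by constructor <;> linarith) (by norm_num)
    (abs_pow_mul_pow_le (m := 3) (n := 1) hx1 hy1 (by norm_num))
  have a32 := sub_le_mul_of_abs_sub_le (a := 1)
    (c := 1) (ε := 1 / 1000) (by constructor <;> linarith) (by norm_num)
    (abs_pow_mul_pow_le (m := 3) (n := 2) hx1 hy1 (by norm_num))
  have hm := taylor_model_nonneg (x := x) (y := y) (by linarith) (by linarith) (by linarith)
  have key : ratioF κ q' t' = ratioF κ q t + ratioFq κ q t * x + ratioFt κ q t * y +
      (q ^ 3 + 324 * q ^ 2 * t * κ - 36 * q ^ 2 * t - 24 * q ^ 2 * κ + 22 * q ^ 2 - 432 * q * t * κ +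
      q + 144 * t * κ) * (x ^ 0 * y ^ 2) +
      (108 * q ^ 2 * κ - 12 * q ^ 2 - 144 * q * κ + 48 * κ) * (x ^ 0 * y ^ 3) +
      (6 * q ^ 2 * t + 48 * q ^ 2 * κ - 6 * q ^ 2 + 648 * q * t ^ 2 * κ - 72 * q * t ^ 2 - 96 * q * t * κ +
      88 * q * t - 8 * q * κ - 16 * q - 432 * t ^ 2 * κ + 2 * t - 2) * (x ^ 1 * y ^ 1) +
      (3 * q ^ 2 + 648 * q * t * κ - 72 * q * t - 48 * q * κ + 44 * q - 432 * t * κ + 1) * (x ^ 1 * y ^ 2) +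
      (216 * q * κ - 24 * q - 144 * κ) * (x ^ 1 * y ^ 3) +
      (3 * q * t ^ 2 + 48 * q * t * κ - 6 * q * t + 3 * q + 108 * t ^ 3 * κ - 12 * t ^ 3 - 24 * t ^ 2 * κ +
      22 * t ^ 2 - 4 * t * κ - 8 * t - 2) * (x ^ 2 * y ^ 0) +
      (6 * q * t + 48 * q * κ - 6 * q + 324 * t ^ 2 * κ - 36 * t ^ 2 - 48 * t * κ + 44 * t - 4 * κ -
      8) * (x ^ 2 * y ^ 1) +
      (3 * q + 324 * t * κ - 36 * t - 24 * κ + 22) * (x ^ 2 * y ^ 2) +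
      (108 * κ - 12) * (x ^ 2 * y ^ 3) +
      (t ^ 2 + 16 * t * κ - 2 * t + 1) * (x ^ 3 * y ^ 0) +
      (2 * t + 16 * κ - 2) * (x ^ 3 * y ^ 1) +
      (1) * (x ^ 3 * y ^ 2) := by
    subst hx hy
    simp only [ratioF, ratioFq, ratioFt]
    ring
  rw [key, h0, hFq, hFt]
  simp only [pow_zero, pow_one, one_mul, mul_one] at *
  linarith

/-! ### `C₆` as the largest root of its polynomial, and its decimals. -/

/-- After the shift to `309/5` every coefficient except the constant one is positive, so `polySq` is
strictly increasing from there on. A root beyond `309/5` is therefore the largest one, and it can be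
located by signs. -/
theorem polySq_shift (s : ℝ) : polySq (309 / 5 + s) =
    6967296 * s ^ 10 + 6321763584 * s ^ 9 + 2157911195760 * s ^ 8 + 9890431112451447 / 25 * s ^ 7 +
    5546850861641247108 / 125 * s ^ 6 + 10032605358904509507438 / 3125 * s ^ 5 + 472584924260425414053156 / 3125 * s ^ 4 +
    14057679001265468738884647 / 3125 * s ^ 3 + 6012679558925764040288670888 / 78125 * s ^ 2 +
    225768628662611052022968888432 / 390625 * s - 161574170830707463386378857984 / 9765625 := by
  simp only [polySq]
  ring

theorem polySq_lt {u v : ℝ} (hu : 309 / 5 ≤ u) (huv : u < v) : polySq u < polySq v := by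
  obtain ⟨a, rfl⟩ : ∃ a, u = 309 / 5 + a := ⟨u - 309 / 5, by ring⟩
  obtain ⟨b, rfl⟩ : ∃ b, v = 309 / 5 + b := ⟨v - 309 / 5, by ring⟩
  have ha : 0 ≤ a := by linarith
  have hab : a < b := by linarith
  have h : ∀ n : ℕ, a ^ n ≤ b ^ n := fun n => pow_le_pow_left₀ ha hab.le n
  rw [polySq_shift, polySq_shift]
  linarith [h 2, h 3, h 4, h 5, h 6, h 7, h 8, h 9, h 10]

theorem eval_polyC6 (x : ℝ) : polyC6.eval x = polySq (x ^ 2) := by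
  simp only [polyC6, polySq, Polynomial.eval_add, Polynomial.eval_sub, Polynomial.eval_mul,
    Polynomial.eval_pow, Polynomial.eval_X, Polynomial.eval_ofNat]
  ring

theorem isGreatest_root_polyC6 {κ : ℝ} (hκ : 309 / 5 ≤ κ) (h : polySq κ = 0) :
    IsGreatest {x : ℝ | polyC6.IsRoot x} √κ := by
  have h0 : √κ ^ 2 = κ := Real.sq_sqrt (by linarith)
  refine ⟨?_, fun x hx => ?_⟩
  · rw [Set.mem_ofPred_eq, Polynomial.IsRoot, eval_polyC6, h0, h]
  · rw [Set.mem_ofPred_eq, Polynomial.IsRoot, eval_polyC6] at hx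
    refine Real.le_sqrt_of_sq_le (not_lt.1 fun hlt => ?_)
    linarith [polySq_lt hκ hlt]

theorem abs_sqrt_sub_lt {κ : ℝ} (hκ : 309 / 5 ≤ κ) (h : polySq κ = 0) :
    |√κ - 7.8631112181| < 5 * (10 : ℝ)⁻¹ ^ 11 := by
  have h1 : (7.8631112181 - 5 * (10 : ℝ)⁻¹ ^ 11) ^ 2 < κ := by
    refine not_le.1 fun hle => ?_
    have h2 : polySq ((7.8631112181 - 5 * (10 : ℝ)⁻¹ ^ 11) ^ 2) < 0 := by
      norm_num [polySq]
    rcases hle.eq_or_lt with he | hlt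
    · rw [← he, h] at h2; exact lt_irrefl _ h2
    · linarith [polySq_lt hκ hlt]
  have h2 : κ < (7.8631112181 + 5 * (10 : ℝ)⁻¹ ^ 11) ^ 2 := by
    refine not_le.1 fun hle => ?_
    have h3 : 0 < polySq ((7.8631112181 + 5 * (10 : ℝ)⁻¹ ^ 11) ^ 2) := by
      norm_num [polySq]
    rcases hle.eq_or_lt with he | hlt
    · rw [he, h] at h3; exact lt_irrefl _ h3
    · linarith [polySq_lt (by norm_num) hlt]
  rw [abs_lt]
  constructor
  · linarith [Real.lt_sqrt_of_sq_lt h1]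
  · linarith [(Real.sqrt_lt' (by norm_num)).2 h2]

/-! ### The sharp bound for the pair `(3,7)`. -/

theorem num_den_eq_ratioF (κ : ℝ) {p q w : ℝ} (hp : p ≠ 0) (hq : q ≠ 0) :
    num 3 p q w * den 7 p q w - κ * num 7 p q w * den 3 p q w =
      p ^ 8 * q ^ 3 * ratioF κ (q / p ^ 2) (w / (p * q)) := by
  simp only [num, den, ratioF]
  field_simp
  ring

/-- In the middle range of `t` the Taylor argument applies. Outside it, `ratioF 62` is nonnegative,
and since `κ < 62` while `num 7 ≥ 0`, replacing `62` by `κ` only increases the expression. The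
region `3 t ≤ q ≤ 1/3` encodes `q² ≥ 3 p w` and `p² ≥ 3 q`. -/
theorem lower_3_7 {q t κ : ℝ}
    (hq : 1285884121 / 5000000000 ≤ q ∧ q ≤ 2571768243 / 10000000000)
    (ht : 302212609 / 5000000000 ≤ t ∧ t ≤ 604425219 / 10000000000)
    (hκ : 30914259 / 500000 ≤ κ ∧ κ ≤ 61828519 / 1000000)
    (h0 : ratioF κ q t = 0) (hFq : ratioFq κ q t = 0) (hFt : ratioFt κ q t = 0) (T : Tri) :
    √κ * D T 6 7 ≤ D T 6 3 := by
  rw [← one_mul (D T 6 3)]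
  refine mul_D_le_mul_D (by decide) (by decide) zero_le_one ?_ T
  intro x u v hx hu hv P Q w hP hQ hw
  have P0 : 0 < P := by rw [hP]; positivity
  have Q0 : 0 < Q := by rw [hQ]; positivity
  have w0 : 0 < w := by rw [hw]; positivity
  have h1 : Q / P ^ 2 ≤ 1 / 3 := by
    rw [div_le_div_iff₀ (by positivity) (by norm_num), ← sub_nonneg, hP, hQ]
    ring_nf
    positivity
  have h2 : 3 * (w / (P * Q)) ≤ Q / P ^ 2 := by
    rw [← mul_div_assoc, div_le_div_iff₀ (by positivity) (by positivity), ← sub_nonneg, hP, hQ, hw]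
    ring_nf
    positivity
  have h7 : 0 ≤ num 7 P Q w := by
    rw [hP, hQ, hw]
    simp only [num]
    ring_nf
    positivity
  have hF := num_den_eq_ratioF κ (w := w) P0.ne' Q0.ne'
  rw [Real.sq_sqrt (by linarith), one_pow, one_mul, hF]
  by_cases hm : 1 / 60 ≤ w / (P * Q) ∧ w / (P * Q) ≤ 9 / 100
  · exact mul_nonneg (by positivity) (ratioF_nonneg_near hq ht hκ h0 hFq hFt h2 h1 hm.1 hm.2)
  · have h62 : 0 ≤ ratioF 62 (Q / P ^ 2) (w / (P * Q)) := by
      rcases le_total (w / (P * Q)) (1 / 60) with h | h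
      · exact ratioF_nonneg_of_le (by positivity) h1 (by positivity) h
      · exact ratioF_nonneg_of_ge h2 h1 (not_lt.1 fun h' => hm ⟨h, h'.le⟩)
    have hF' := num_den_eq_ratioF 62 (w := w) P0.ne' Q0.ne'
    have h3 : 0 ≤ (62 - κ) * (num 7 P Q w * den 3 P Q w) :=
      mul_nonneg (by linarith) (mul_nonneg h7 (den_pos 3 P0 Q0 w0).le)
    have h4 : 0 ≤ P ^ 8 * Q ^ 3 * ratioF 62 (Q / P ^ 2) (w / (P * Q)) :=
      mul_nonneg (by positivity) h62
    rw [← hF]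
    linarith

/-- The critical parameters must come from an actual triangle. The cubic with these symmetric
functions changes sign between `0, 3/20, 2/5, 1`, so it has three distinct positive roots, and the
extremal triangle is scalene. -/
theorem exists_crit_tri {q t : ℝ}
    (hq : 1285884121 / 5000000000 ≤ q ∧ q ≤ 2571768243 / 10000000000)
    (ht : 302212609 / 5000000000 ≤ t ∧ t ≤ 604425219 / 10000000000) :
    ∃ x y z : ℝ, 0 < x ∧ 0 < y ∧ 0 < z ∧ x + y + z = 1 ∧
    x * y + y * z + z * x = q ∧ x * y * z = q * t := by
  obtain ⟨f, hf⟩ : ∃ f : ℝ → ℝ, f = fun X => X ^ 3 - X ^ 2 + q * X - q * t := ⟨_, rfl⟩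
  have hc : Continuous f := by rw [hf]; fun_prop
  have hqt := mul_mem_Icc hq ht (L := 155 / 10000) (U := 156 / 10000) (by norm_num) (by norm_num)
    (by norm_num) (by norm_num)
  have f0 : f 0 < 0 := by simp only [hf]; linarith
  have f1 : 0 < f (3 / 20) := by simp only [hf]; linarith
  have f2 : f (2 / 5) < 0 := by simp only [hf]; linarith
  have f3 : 0 < f 1 := by simp only [hf]; linarith
  obtain ⟨x, hx, ex⟩ := intermediate_value_Ioo (by norm_num) hc.continuousOn ⟨f0, f1⟩
  obtain ⟨y, hy, ey⟩ := intermediate_value_Ioo' (by norm_num) hc.continuousOn ⟨f2, f1⟩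
  obtain ⟨z, hz, ez⟩ := intermediate_value_Ioo (by norm_num) hc.continuousOn ⟨f2, f3⟩
  simp only [hf] at ex ey ez
  have hxy : x - y ≠ 0 := by linarith [hx.2, hy.1]
  have hxz : x - z ≠ 0 := by linarith [hx.2, hz.1]
  have hyz : y - z ≠ 0 := by linarith [hy.2, hz.1]
  -- Vieta's formulas by divided differences: the first differences are divided by `x - y` and `x -
  -- z`, and the second difference by `y - z`.
  have a1 : x ^ 2 + x * y + y ^ 2 - (x + y) + q = 0 :=
    mul_left_cancel₀ hxy (by linear_combination ex - ey)
  have a2 : x ^ 2 + x * z + z ^ 2 - (x + z) + q = 0 :=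
    mul_left_cancel₀ hxz (by linear_combination ex - ez)
  have a3 : x + y + z - 1 = 0 := mul_left_cancel₀ hyz (by linear_combination a1 - a2)
  refine ⟨x, y, z, hx.1, by linarith [hy.1], by linarith [hz.1], by linarith, ?_, ?_⟩
  · linear_combination (x + y) * a3 - a1
  · linear_combination ex + x * y * a3 - x * a1

/-- The infimum is attained: the triangle with the critical parameters has ratio exactly `√κ`. -/
theorem approaches_lower_3_7 {q t κ : ℝ}
    (hq : 1285884121 / 5000000000 ≤ q ∧ q ≤ 2571768243 / 10000000000)
    (ht : 302212609 / 5000000000 ≤ t ∧ t ≤ 604425219 / 10000000000)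
    (hκ : 30914259 / 500000 ≤ κ ∧ κ ≤ 61828519 / 1000000)
    (h0 : ratioF κ q t = 0) : Approaches 3 7 √κ := by
  obtain ⟨x, y, z, hx, hy, hz, e1, e2, e3⟩ := exists_crit_tri hq ht
  obtain ⟨T, ha, hb, hc⟩ := exists_tri hx hy hz
  have d3 := D_sq T hx hy hz ha hb hc (n := 3) (by decide)
  have d7 := D_sq T hx hy hz ha hb hc (n := 7) (by decide)
  rw [e1, e2, e3] at d3 d7
  have q0 : 0 < q := by linarith
  have t0 : 0 < t := by linarith
  have hF := num_den_eq_ratioF κ (w := q * t) one_ne_zero q0.ne'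
  have e4 : q / 1 ^ 2 = q := by ring
  have e5 : q * t / (1 * q) = t := by field_simp
  rw [e4, e5, h0, mul_zero, ← d3, ← d7] at hF
  have p3 := den_pos 3 one_pos q0 (mul_pos q0 t0)
  have p7 := den_pos 7 one_pos q0 (mul_pos q0 t0)
  have p1 : 0 < 4 * (1 ^ 2 - q) ^ 2 := by
    have : 0 < 1 ^ 2 - q := by linarith
    positivity
  have hsq : D T 6 3 ^ 2 = κ * D T 6 7 ^ 2 := by
    refine mul_left_cancel₀ (mul_pos (mul_pos p1 p3) p7).ne' ?_
    linear_combination hF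
  -- If `D(6,7)` vanished, only the first summand of `ratioF` would survive, and it is positive at
  -- the critical point, contradicting `ratioF κ q t = 0`.
  have h7 : D T 6 7 ≠ 0 := by
    intro h
    rw [h] at d7
    simp only [num] at d7
    have hqt := mul_mem_Icc hq ht (L := 155 / 10000) (U := 156 / 10000) (by norm_num)
      (by norm_num) (by norm_num) (by norm_num)
    have h1 : 0 < q * (1 - t) ^ 2 * ((1 - q) ^ 2 - 12 * q * t) := by
      have : 0 < (1 - q) ^ 2 - 12 * q * t := by nlinarith
      have : 0 < 1 - t := by linarith
      positivity
    have h2 : q ^ 2 * ratioF κ q t =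
        q ^ 2 * (q * (1 - t) ^ 2 * ((1 - q) ^ 2 - 12 * q * t)) := by
      simp only [ratioF]
      linear_combination (4 * κ * t) * d7
    rw [h0, mul_zero] at h2
    linarith [mul_pos (pow_pos q0 2) h1]
  have hs : D T 6 3 = √κ * D T 6 7 := by
    refine (sq_eq_sq₀ (show 0 ≤ D T 6 3 from dist_nonneg)
      (mul_nonneg (Real.sqrt_nonneg _) (show 0 ≤ D T 6 7 from dist_nonneg))).1 ?_
    rw [mul_pow, Real.sq_sqrt (by linarith), hsq]
  intro ε hε
  refine ⟨T, ?_, h7, ?_⟩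
  · rw [hs]
    exact mul_ne_zero (Real.sqrt_pos.2 (by linarith)).ne' h7
  · rw [hs, mul_div_cancel_right₀ _ h7, sub_self, abs_zero]
    exact hε

end TriangleCenters

theorem mainTheorem3 :
    ∃ C₆ : ℝ, IsGreatest {x : ℝ | polyC6.IsRoot x} C₆ ∧
      |C₆ - 7.8631112181| < 5 * (10 : ℝ)⁻¹ ^ 11 ∧
      (BestLower 6 1 2 0 ∧ BestUpper 6 1 2 (9 - 6 * √2)) ∧
      (BestLower 6 1 3 0 ∧ BestUpper 6 1 3 (2 - √3)) ∧
      (BestLower 6 1 4 0 ∧ NoUpper 6 1 4) ∧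
      (BestLower 6 1 5 0 ∧ NoUpper 6 1 5) ∧
      (BestLower 6 1 7 (1 / 2) ∧ NoUpper 6 1 7) ∧
      (BestLower 6 1 8 0 ∧ BestUpper 6 1 8 ((2 * √2 - 1) / 7)) ∧
      (BestLower 6 1 9 0 ∧ BestUpper 6 1 9 (1 / 3)) ∧
      (BestLower 6 1 10 0 ∧ BestUpper 6 1 10 (√2 - 1)) ∧
      (BestLower 6 2 3 0 ∧ BestUpper 6 2 3 (2 / 3)) ∧
      (BestLower 6 2 4 0 ∧ NoUpper 6 2 4) ∧
      (BestLower 6 2 5 0 ∧ NoUpper 6 2 5) ∧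
      (BestLower 6 2 7 1 ∧ NoUpper 6 2 7) ∧
      (BestLower 6 2 8 (1 / 3) ∧ BestUpper 6 2 8 ((5 + 4 * √2) / 21)) ∧
      (BestLower 6 2 9 (1 / 2) ∧ BestUpper 6 2 9 (3 / 4)) ∧
      (BestLower 6 2 10 (2 / 3) ∧ BestUpper 6 2 10 ((1 + √2) / 3)) ∧
      (BestLower 6 3 4 (1 / 2) ∧ NoUpper 6 3 4) ∧
      (BestLower 6 3 5 2 ∧ NoUpper 6 3 5) ∧
      (BestLower 6 3 7 C₆ ∧ NoUpper 6 3 7) ∧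
      (BestLower 6 3 8 (1 / 2) ∧ NoUpper 6 3 8) ∧
      (BestLower 6 3 9 1 ∧ NoUpper 6 3 9) ∧
      (BestLower 6 3 10 1 ∧ NoUpper 6 3 10) ∧
      (BestLower 6 4 5 0 ∧ NoUpper 6 4 5) ∧
      (BestLower 6 4 7 0 ∧ NoUpper 6 4 7) ∧
      (BestLower 6 4 8 0 ∧ NoUpper 6 4 8) ∧
      (BestLower 6 4 9 0 ∧ NoUpper 6 4 9) ∧
      (BestLower 6 4 10 0 ∧ NoUpper 6 4 10) ∧
      (BestLower 6 5 7 0 ∧ NoUpper 6 5 7) ∧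
      (BestLower 6 5 8 0 ∧ NoUpper 6 5 8) ∧
      (BestLower 6 5 9 0 ∧ NoUpper 6 5 9) ∧
      (BestLower 6 5 10 0 ∧ NoUpper 6 5 10) ∧
      (BestLower 6 7 8 0 ∧ BestUpper 6 7 8 (1 / 2)) ∧
      (BestLower 6 7 9 0 ∧ BestUpper 6 7 9 (1 / 2)) ∧
      (BestLower 6 7 10 0 ∧ BestUpper 6 7 10 (4 / 5)) ∧
      (BestLower 6 8 9 1 ∧ BestUpper 6 8 9 2) ∧
      (BestLower 6 8 10 (3 - √2) ∧ BestUpper 6 8 10 2) ∧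
      (BestLower 6 9 10 1 ∧ BestUpper 6 9 10 (8 / 5)) := by
  obtain ⟨q, t, κ, hq, ht, hκ, h0, hFq, hFt, hP⟩ := exists_crit
  have hκ' : 309 / 5 ≤ κ := by linarith
  refine ⟨√κ, isGreatest_root_polyC6 hκ' hP, abs_sqrt_sub_lt hκ' hP,
    ⟨bestLower_zero_of_approaches approaches_lower_1_2,
      bestUpper_of_approaches upper_1_2 approaches_upper_1_2⟩,
    ⟨bestLower_zero_of_approaches approaches_lower_1_3,
      bestUpper_of_approaches upper_1_3 approaches_upper_1_3⟩,
    ⟨bestLower_zero_of_approaches approaches_lower_1_4,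
      noUpper_of_approaches approaches_inv_1_4⟩,
    ⟨bestLower_zero_of_approaches approaches_lower_1_5,
      noUpper_of_approaches approaches_inv_1_5⟩,
    ⟨bestLower_of_approaches lower_1_7 approaches_lower_1_7,
      noUpper_of_approaches approaches_inv_1_7⟩,
    ⟨bestLower_zero_of_approaches approaches_lower_1_8,
      bestUpper_of_approaches upper_1_8 approaches_upper_1_8⟩,
    ⟨bestLower_zero_of_approaches approaches_lower_1_9,
      bestUpper_of_approaches upper_1_9 approaches_upper_1_9⟩,
    ⟨bestLower_zero_of_approaches approaches_lower_1_10,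
      bestUpper_of_approaches upper_1_10 approaches_upper_1_10⟩,
    ⟨bestLower_zero_of_approaches approaches_lower_2_3,
      bestUpper_of_approaches upper_2_3 approaches_upper_2_3⟩,
    ⟨bestLower_zero_of_approaches approaches_lower_2_4,
      noUpper_of_approaches approaches_inv_2_4⟩,
    ⟨bestLower_zero_of_approaches approaches_lower_2_5,
      noUpper_of_approaches approaches_inv_2_5⟩,
    ⟨bestLower_of_approaches lower_2_7 approaches_lower_2_7,
      noUpper_of_approaches approaches_inv_2_7⟩,
    ⟨bestLower_of_approaches lower_2_8 approaches_lower_2_8,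
      bestUpper_of_approaches upper_2_8 approaches_upper_2_8⟩,
    ⟨bestLower_of_approaches lower_2_9 approaches_lower_2_9,
      bestUpper_of_approaches upper_2_9 approaches_upper_2_9⟩,
    ⟨bestLower_of_approaches lower_2_10 approaches_lower_2_10,
      bestUpper_of_approaches upper_2_10 approaches_upper_2_10⟩,
    ⟨bestLower_of_approaches lower_3_4 approaches_lower_3_4,
      noUpper_of_approaches approaches_inv_3_4⟩,
    ⟨bestLower_of_approaches lower_3_5 approaches_lower_3_5,
      noUpper_of_approaches approaches_inv_3_5⟩,
    ⟨bestLower_of_approaches (lower_3_7 hq ht hκ h0 hFq hFt)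
      (approaches_lower_3_7 hq ht hκ h0),
      noUpper_of_approaches approaches_inv_3_7⟩,
    ⟨bestLower_of_approaches lower_3_8 approaches_lower_3_8,
      noUpper_of_approaches approaches_inv_3_8⟩,
    ⟨bestLower_of_approaches lower_3_9 approaches_lower_3_9,
      noUpper_of_approaches approaches_inv_3_9⟩,
    ⟨bestLower_of_approaches lower_3_10 approaches_lower_3_10,
      noUpper_of_approaches approaches_inv_3_10⟩,
    ⟨bestLower_zero_of_approaches approaches_lower_4_5,
      noUpper_of_approaches approaches_inv_4_5⟩,
    ⟨bestLower_zero_of_approaches approaches_lower_4_7,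
      noUpper_of_approaches approaches_inv_4_7⟩,
    ⟨bestLower_zero_of_approaches approaches_lower_4_8,
      noUpper_of_approaches approaches_inv_4_8⟩,
    ⟨bestLower_zero_of_approaches approaches_lower_4_9,
      noUpper_of_approaches approaches_inv_4_9⟩,
    ⟨bestLower_zero_of_approaches approaches_lower_4_10,
      noUpper_of_approaches approaches_inv_4_10⟩,
    ⟨bestLower_zero_of_approaches approaches_lower_5_7,
      noUpper_of_approaches approaches_inv_5_7⟩,
    ⟨bestLower_zero_of_approaches approaches_lower_5_8,
      noUpper_of_approaches approaches_inv_5_8⟩,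
    ⟨bestLower_zero_of_approaches approaches_lower_5_9,
      noUpper_of_approaches approaches_inv_5_9⟩,
    ⟨bestLower_zero_of_approaches approaches_lower_5_10,
      noUpper_of_approaches approaches_inv_5_10⟩,
    ⟨bestLower_zero_of_approaches approaches_lower_7_8,
      bestUpper_of_approaches upper_7_8 approaches_upper_7_8⟩,
    ⟨bestLower_zero_of_approaches approaches_lower_7_9,
      bestUpper_of_approaches upper_7_9 approaches_upper_7_9⟩,
    ⟨bestLower_zero_of_approaches approaches_lower_7_10,
      bestUpper_of_approaches upper_7_10 approaches_upper_7_10⟩,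
    ⟨bestLower_of_approaches lower_8_9 approaches_lower_8_9,
      bestUpper_of_approaches upper_8_9 approaches_upper_8_9⟩,
    ⟨bestLower_of_approaches lower_8_10 approaches_lower_8_10,
      bestUpper_of_approaches upper_8_10 approaches_upper_8_10⟩,
    ⟨bestLower_of_approaches lower_9_10 approaches_lower_9_10,
      bestUpper_of_approaches upper_9_10 approaches_upper_9_10⟩⟩
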